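/- For $h\ge 0$ let $Q_h$ be the hypercube graph on $\{0,1\}^h$, in which two words are adjacent if and only if they differ in exactly one position. For a non-empty set $X\subseteq\{0,1\}^k$ the daisy cube $Q_k(X)$ is the subgraph of $Q_k$ induced by $\{v : v\le x \text{ for some } x\in X\}$, where $\le$ is the coordinatewise order. A map $\beta:V(G)\to\{0,1\}^h$ is an isometric embedding of a connected graph $G$ into $Q_h$ if $d_{Q_h}(\beta(u),\beta(v))=d_G(u,v)$ for all $u,v\in V(G)$; the isometric dimension of $G$ is the least $h$ for which such a map exists. **Theorem.** There is an algorithm which, given only the adjacency lists of a graph $G$ that is isomorphic to a daisy cube, computes the isometric dimension $h$ of $G$ and an isometric embedding $\beta$ of $G$ into $Q_h$ in linear time, that is, in $O(m+1)$ steps, where $m$ is the number of edges of $G$ (note that $|V(G)|\le m+1$, as $G$ is connected). More precisely, there are a program of a random access machine and a constant $C$ such that, for every such $G$ with vertex set $\{0,\dots,n-1\}$, on words of any length $w\ge C(h+1)$ bits (so that a label $\beta(v)$ is stored in one word) the program halts without overflow after at most $C(m+1)$ steps. One step is one assignment of a constant, addition, subtraction, bitwise OR, indirect read or write of an array cell,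 or comparison of two words. The computed embedding comes from a breadth-first search: the program also outputs a breadth-first order of the vertices of $G$, starting at a vertex $u$ of degree $h$, such that $\beta(u)=0^h$, the $h$ neighbours of $u$ get the $h$ different unit vectors, and every vertex $v\notin\{u\}\cup N(u)$ satisfies $\beta(v)=\beta(z)\lor\beta(z')$ (bitwise OR) for two distinct neighbours $z,z'$ of $v$ with $d(u,z)=d(u,z')=d(u,v)-1$. -/

import Mathlib

namespace Daisy

/-! ### Hypercubes, daisy cubes, isometric embeddings -/

/-- The `h`-cube: binary words of length `h`, adjacent when they differ in exactly one position. -/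
def hypercube (h : ℕ) : SimpleGraph (Fin h → Bool) where
  Adj x y := hammingDist x y = 1
  symm := ⟨fun x y hxy => by rw [hammingDist_comm]; exact hxy⟩
  loopless := ⟨fun x hx => by simp at hx⟩

/-- The vertex set of the daisy cube generated by `X`: the words below some word of `X`
(in the coordinatewise order, `false < true`). -/
def daisySet {h : ℕ} (X : Set (Fin h → Bool)) : Set (Fin h → Bool) :=
  {v | ∃ x ∈ X, v ≤ x}

/-- The daisy cube `Q_h(X)`, an induced subgraph of the `h`-cube. -/
def daisyCube (h : ℕ) (X : Set (Fin h → Bool)) : SimpleGraph (daisySet X) :=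
  (hypercube h).induce (daisySet X)

/-- `G` is isomorphic to a daisy cube generated by some non-empty set of binary words. -/
def IsDaisyCube {V : Type*} (G : SimpleGraph V) : Prop :=
  ∃ (k : ℕ) (X : Set (Fin k → Bool)), X.Nonempty ∧ Nonempty (G ≃g daisyCube k X)

/-- Isometric embedding of a (connected) graph into the `h`-cube. -/
def IsIsometricEmbedding {V : Type*} (G : SimpleGraph V) {h : ℕ} (α : V → (Fin h → Bool)) : Prop :=
  ∀ u v, (hypercube h).dist (α u) (α v) = G.dist u v

/-- `h` is the isometric dimension of `G`: the least `k` such that `G` embeds isometrically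
into the `k`-cube. -/
def IsIsometricDimension {V : Type*} (G : SimpleGraph V) (h : ℕ) : Prop :=
  IsLeast {k : ℕ | ∃ α : V → (Fin k → Bool), IsIsometricEmbedding G α} h

/-- `N^u(v)`: the neighbours of `v` that are closer to `u` than `v` is. -/
def predecessors {V : Type*} (G : SimpleGraph V) (u v : V) : Set V :=
  {z | G.Adj v z ∧ G.dist u z + 1 = G.dist u v}

/-- The word with a single `1`, in position `i`. -/
def unitWord {h : ℕ} (i : Fin h) : Fin h → Bool := fun j => decide (j = i)

/-- `σ` (position ↦ vertex) lists the vertices of the connected graph `G` in an order in which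
a breadth-first search started at `u` can visit them: `u` comes first, and if `a` comes before `b`
and `b` before `c`, and `c` but not `b` is a neighbour of `a`, then `b` has a neighbour that
comes before `a`. -/
def IsBFSOrder {n : ℕ} (G : SimpleGraph (Fin n)) (u : Fin n) (σ : Equiv.Perm (Fin n)) : Prop :=
  (σ.symm u : ℕ) = 0 ∧
    ∀ a b c : Fin n, a < b → b < c → G.Adj (σ a) (σ c) → ¬ G.Adj (σ a) (σ b) →
      ∃ d : Fin n, d < a ∧ G.Adj (σ d) (σ b)

/-- The labelling `β` is built along the breadth-first order `σ` from the vertex `u` of degree `h`: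
`u` is labelled `0 ^ h`, the neighbours of `u` get the `h` different unit words, and every other
vertex gets the bitwise OR of the labels of two of its predecessors. -/
structure IsBFSLabelling {n h : ℕ} (G : SimpleGraph (Fin n)) [DecidableRel G.Adj]
    (u : Fin n) (σ : Equiv.Perm (Fin n)) (β : Fin n → (Fin h → Bool)) : Prop where
  degree_root : G.degree u = h
  bfs : IsBFSOrder G u σ
  root : β u = fun _ => false
  neighbours : ∃ e : Fin h ≃ G.neighborSet u, ∀ i, β (e i) = unitWord i
  later : ∀ v, v ≠ u → ¬ G.Adj u v →
    ∃ z ∈ predecessors G u v, ∃ z' ∈ predecessors G u v, z ≠ z' ∧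
      β v = fun i => β z i || β z' i

/-! ### A word RAM -/

/-- The store of the machine: numbered registers and numbered arrays, all holding naturals.
A program, being finite, refers to finitely many registers and arrays. -/
structure Store where
  reg : ℕ → ℕ
  arr : ℕ → ℕ → ℕ

/-- Put the value `k` into register `x`. -/
def Store.setReg (s : Store) (x k : ℕ) : Store :=
  { s with reg := Function.update s.reg x k }

/-- Put the value `k` into cell `i` of array `a`. -/
def Store.setArr (s : Store) (a i k : ℕ) : Store :=
  { s with arr := Function.update s.arr a (Function.update (s.arr a) i k) }

/-- Programs; all arguments are literals: `x y z` are register numbers, `a` is an array number. -/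
inductive Prog where
  /-- `x := k` -/
  | const (x k : ℕ)
  /-- `x := y + z` -/
  | add (x y z : ℕ)
  /-- `x := y - z` (truncated) -/
  | sub (x y z : ℕ)
  /-- `x := y OR z` (bitwise) -/
  | bitOr (x y z : ℕ)
  /-- `x := a[y]` -/
  | load (x a y : ℕ)
  /-- `a[x] := y` -/
  | store (a x y : ℕ)
  /-- first `c`, then `d` -/
  | seq (c d : Prog)
  /-- if `x < y` then `c` else `d` -/
  | ifLt (x y : ℕ) (c d : Prog)
  /-- while `x < y` do `c` -/
  | whileLt (x y : ℕ) (c : Prog)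

/-- `Exec w P s t s'`: on a machine with words of `w` bits, the program `P` started in `s` halts
in `s'` after exactly `t` steps. Every elementary instruction and every test of a condition is one
step. A value that does not fit in a word cannot be written: on overflow there is no run. -/
inductive Exec (w : ℕ) : Prog → Store → ℕ → Store → Prop
  | const (s : Store) (x k : ℕ) (hk : k < 2 ^ w) :
      Exec w (.const x k) s 1 (s.setReg x k)
  | add (s : Store) (x y z : ℕ) (hk : s.reg y + s.reg z < 2 ^ w) :
      Exec w (.add x y z) s 1 (s.setReg x (s.reg y + s.reg z))
  | sub (s : Store) (x y z : ℕ) (hk : s.reg y - s.reg z < 2 ^ w) :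
      Exec w (.sub x y z) s 1 (s.setReg x (s.reg y - s.reg z))
  | bitOr (s : Store) (x y z : ℕ) (hk : s.reg y ||| s.reg z < 2 ^ w) :
      Exec w (.bitOr x y z) s 1 (s.setReg x (s.reg y ||| s.reg z))
  | load (s : Store) (x a y : ℕ) (hk : s.arr a (s.reg y) < 2 ^ w) :
      Exec w (.load x a y) s 1 (s.setReg x (s.arr a (s.reg y)))
  | store (s : Store) (a x y : ℕ) (hk : s.reg y < 2 ^ w) :
      Exec w (.store a x y) s 1 (s.setArr a (s.reg x) (s.reg y))
  | seq {c d : Prog} {s s' s'' : Store} {t t' : ℕ}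
      (hc : Exec w c s t s') (hd : Exec w d s' t' s'') :
      Exec w (.seq c d) s (t + t') s''
  | ifLt_true {x y : ℕ} {c d : Prog} {s s' : Store} {t : ℕ}
      (h : s.reg x < s.reg y) (hc : Exec w c s t s') :
      Exec w (.ifLt x y c d) s (t + 1) s'
  | ifLt_false {x y : ℕ} {c d : Prog} {s s' : Store} {t : ℕ}
      (h : ¬ s.reg x < s.reg y) (hd : Exec w d s t s') :
      Exec w (.ifLt x y c d) s (t + 1) s'
  | whileLt_true {x y : ℕ} {c : Prog} {s s' s'' : Store} {t t' : ℕ}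
      (h : s.reg x < s.reg y) (hc : Exec w c s t s')
      (hrest : Exec w (.whileLt x y c) s' t' s'') :
      Exec w (.whileLt x y c) s (t + t' + 1) s''
  | whileLt_false {x y : ℕ} {c : Prog} {s : Store}
      (h : ¬ s.reg x < s.reg y) :
      Exec w (.whileLt x y c) s 1 s

/-- The store `s` holds `G` as adjacency lists, each in arbitrary order: register `0` holds the
number of vertices, array `1` holds the adjacency lists of the vertices `0, 1, 2, …` one after the
other, and the list of `v` occupies the cells from `arr 0 v` up to `arr 0 (v + 1)` (exclusive).
Nothing is assumed about the other registers and cells; in particular neither the dimension nor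
any labelling is given. -/
def HoldsGraph {n : ℕ} (s : Store) (G : SimpleGraph (Fin n)) : Prop :=
  ∃ adj : Fin n → List (Fin n),
    (∀ v, (adj v).Nodup ∧ ∀ z, z ∈ adj v ↔ G.Adj v z) ∧
    s.reg 0 = n ∧ s.arr 0 0 = 0 ∧
    ∀ v : Fin n, s.arr 0 ((v : ℕ) + 1) = s.arr 0 v + (adj v).length ∧
      ∀ (j : ℕ) (hj : j < (adj v).length), s.arr 1 (s.arr 0 v + j) = (((adj v)[j]'hj : Fin n) : ℕ)

/-- The store `s` holds the dimension `h` (register `1`), the labelling `β` (cell `v` of array `2`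
is the `h`-bit word `β v`), and the order `σ` (array `3`). -/
def HoldsLabelling {n h : ℕ} (s : Store) (β : Fin n → (Fin h → Bool))
    (σ : Equiv.Perm (Fin n)) : Prop :=
  s.reg 1 = h ∧
    (∀ v : Fin n, s.arr 2 v < 2 ^ h ∧ ∀ i : Fin h, (s.arr 2 v).testBit i = β v i) ∧
    ∀ i : Fin n, s.arr 3 i = (σ i : ℕ)

end Daisy

namespace Daisy

/-! Identify `G` with a lower set of words in a cube (`IsDaisyLabelling`). Any two of its vertices
are joined inside the set by a path of Hamming length: first erase superfluous ones, then add
missing ones. Hence distances in `G` are Hamming distances (`dist_eq`).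

Let `u` have maximum degree; it need not be the zero word. The zero word has a neighbour for each
position used by some vertex, so `u` has at least that many neighbours, and every used position can
be flipped at `u` (`flip_mem_of_max_degree`). XOR with the word of `u`, followed by restriction to
the directions of the edges at `u`, gives an isometric embedding with `u` at the origin
(`exists_rooted`). No isometric embedding fits in fewer dimensions than a degree (`degree_le`), so
the dimension equals the maximum degree and can be read off the input.

A predecessor of `v` with respect to `u` has the word of `v` with a single one erased. By
`exists_two_flips`, each vertex outside `u` and its neighbours has two distinct predecessors, whose
OR is therefore its word. Including further predecessors does no harm, as all lie below `v`. A
breadth-first order is monotone in the distance from `u` (`lt_of_dist_lt`), and adjacent vertices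
are at different distances (`dist_ne`), so the predecessors of `v` are exactly its earlier
neighbours. The labels thus satisfy a recursion along the search order, started by the unit words at
the neighbours of `u` (`apply_iff`, `testBit_iff`).

The program evaluates this recursion by scanning each adjacency list a bounded number of times. Its
cost is linear in the sum of degrees plus the number of vertices, and so in the number of edges plus
one. Its correctness is shown with a Hoare-style calculus (`Terminates`), in which loop invariants
carry the remaining time budget. -/

/-! ### Words and Hamming distance -/

/-- The word `x` with the letter in position `i` changed. -/
def flip {k : ℕ} (x : Fin k → Bool) (i : Fin k) : Fin k → Bool := Function.update x i (!x i)

theorem flip_self {k : ℕ} (x : Fin k → Bool) (i : Fin k) : flip x i i = !x i := by simp [flip]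

theorem flip_of_ne {k : ℕ} (x : Fin k → Bool) {i j : Fin k} (h : j ≠ i) : flip x i j = x j := by
  simp [flip, h]

theorem flip_injective {k : ℕ} (x : Fin k → Bool) : Function.Injective (flip x) := by
  intro i j h
  by_contra hij
  have h1 := congrFun h i
  rw [flip_self, flip_of_ne x hij] at h1
  simp at h1

theorem hammingDist_flip_of_ne {k : ℕ} {x y : Fin k → Bool} {i : Fin k} (h : x i ≠ y i) :
    hammingDist (flip x i) y + 1 = hammingDist x y := by
  unfold hammingDist
  have : (Finset.univ.filter fun j => x j ≠ y j) =
      insert i (Finset.univ.filter fun j => flip x i j ≠ y j) := by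
    ext j
    by_cases hj : j = i
    · subst hj; simp [h]
    · simp [flip_of_ne x hj, hj]
  rw [this, Finset.card_insert_of_notMem]
  simp only [Finset.mem_filter, flip_self]
  cases hx : x i <;> cases hy : y i <;> simp_all

theorem flip_flip {k : ℕ} (x : Fin k → Bool) (i : Fin k) : flip (flip x i) i = x := by
  simp [flip]

theorem hammingDist_flip_of_eq {k : ℕ} {x y : Fin k → Bool} {i : Fin k} (h : x i = y i) :
    hammingDist (flip x i) y = hammingDist x y + 1 := by
  have := hammingDist_flip_of_ne (x := flip x i) (y := y) (i := i) (by simp [flip_self, h])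
  rw [flip_flip] at this
  exact this.symm

theorem hammingDist_eq_one_iff {k : ℕ} {x y : Fin k → Bool} :
    hammingDist x y = 1 ↔ ∃ i, y = flip x i := by
  constructor
  · intro h
    unfold hammingDist at h
    obtain ⟨i, hi⟩ := Finset.card_eq_one.1 h
    refine ⟨i, funext fun j => ?_⟩
    have hj := Finset.ext_iff.1 hi j
    simp only [Finset.mem_filter, Finset.mem_univ, true_and, Finset.mem_singleton] at hj
    by_cases hji : j = i
    · subst hji
      rw [flip_self]
      have := hj.2 rfl
      cases hx : x j <;> cases hy : y j <;> simp_all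
    · rw [flip_of_ne x hji]
      by_contra hne
      exact hji (hj.1 (Ne.symm hne))
  · rintro ⟨i, rfl⟩
    rw [hammingDist_comm, hammingDist_flip_of_eq rfl, hammingDist_self]

/-! ### Labellings of daisy cubes -/

/-- `α` identifies `G` with the subgraph of the `k`-cube induced by a lower set of words. -/
structure IsDaisyLabelling {V : Type*} (G : SimpleGraph V) {k : ℕ} (α : V → (Fin k → Bool)) :
    Prop where
  injective : Function.Injective α
  adj_iff : ∀ u v, G.Adj u v ↔ hammingDist (α u) (α v) = 1
  lower : ∀ v y, y ≤ α v → ∃ z, α z = y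

theorem IsDaisyCube.exists_labelling {V : Type*} {G : SimpleGraph V} (hG : IsDaisyCube G) :
    Nonempty V ∧ ∃ (k : ℕ) (α : V → (Fin k → Bool)), IsDaisyLabelling G α := by
  obtain ⟨k, X, ⟨x, hx⟩, ⟨f⟩⟩ := hG
  refine ⟨⟨f.symm ⟨x, x, hx, le_rfl⟩⟩, k, fun v => (f v : Fin k → Bool), ?_, ?_, ?_⟩
  · intro a b hab
    exact f.injective (Subtype.ext hab)
  · intro u v
    rw [← f.map_adj_iff]
    rfl
  · rintro v y hy
    obtain ⟨x, hx, hvx⟩ := (f v).2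
    exact ⟨f.symm ⟨y, x, hx, hy.trans hvx⟩, by simp⟩

namespace IsDaisyLabelling

variable {V : Type*} {G : SimpleGraph V} {k : ℕ} {α : V → (Fin k → Bool)}

theorem adj_iff_flip (hα : IsDaisyLabelling G α) {u v : V} :
    G.Adj u v ↔ ∃ i, α v = flip (α u) i := by
  rw [hα.adj_iff, hammingDist_eq_one_iff]

theorem flip_down_mem (hα : IsDaisyLabelling G α) {v : V} {i : Fin k} (hi : α v i = true) :
    ∃ z, α z = flip (α v) i := by
  refine hα.lower v _ fun j => ?_
  by_cases hj : j = i
  · subst hj; simp [flip_self, hi]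
  · rw [flip_of_ne _ hj]

/-- Position `i` is a one of `α y`, so changing `α v` there leaves a word below `α y`. The vertex
`y` serves as a witness that ones may be added. -/
theorem flip_up_mem (hα : IsDaisyLabelling G α) {v y : V} {i : Fin k} (hvy : α v ≤ α y)
    (hi : α y i = true) : ∃ z, α z = flip (α v) i := by
  refine hα.lower y _ fun j => ?_
  by_cases hj : j = i
  · subst hj; rw [hi]; exact Bool.le_true _
  · rw [flip_of_ne _ hj]; exact hvy j

/-- If `α u` has a one that `α v` lacks, erasing it stays in the lower set. Otherwise `α u ≤ α v`,
and adding a missing one stays below `α v`. -/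
theorem exists_closer (hα : IsDaisyLabelling G α) {u v : V} (h : u ≠ v) :
    ∃ z, G.Adj u z ∧ hammingDist (α z) (α v) + 1 = hammingDist (α u) (α v) := by
  suffices ∃ i, α u i ≠ α v i ∧ ∃ z, α z = flip (α u) i by
    obtain ⟨i, hi, z, hz⟩ := this
    exact ⟨z, hα.adj_iff_flip.2 ⟨i, hz⟩, by rw [hz, hammingDist_flip_of_ne hi]⟩
  by_cases hle : α u ≤ α v
  · obtain ⟨i, hi⟩ := Function.ne_iff.1 (hα.injective.ne h)
    have : α v i = true := by
      have hle' : α u i ≤ α v i := hle i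
      revert hi hle'
      cases α u i <;> cases α v i <;> decide
    exact ⟨i, hi, hα.flip_up_mem hle this⟩
  · simp only [Pi.le_def, not_forall] at hle
    obtain ⟨i, hi⟩ := hle
    have h1 : α u i = true ∧ α v i = false := by
      cases hx : α u i <;> cases hy : α v i <;> simp_all
    exact ⟨i, by simp [h1], hα.flip_down_mem h1.1⟩

theorem exists_walk (hα : IsDaisyLabelling G α) (u v : V) :
    ∃ p : G.Walk u v, p.length = hammingDist (α u) (α v) := by
  induction hd : hammingDist (α u) (α v) generalizing u with
  | zero =>
    obtain rfl := hα.injective (hammingDist_eq_zero.1 hd)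
    exact ⟨.nil, rfl⟩
  | succ d ih =>
    have huv : u ≠ v := by rintro rfl; simp at hd
    obtain ⟨z, hz, hzd⟩ := hα.exists_closer huv
    obtain ⟨p, hp⟩ := ih z (by omega)
    exact ⟨.cons hz p, by simp [hp]⟩

theorem hammingDist_le_length (hα : IsDaisyLabelling G α) {u v : V} (p : G.Walk u v) :
    hammingDist (α u) (α v) ≤ p.length := by
  induction p with
  | nil => simp
  | cons h p ih =>
    rename_i a b c
    have h1 := hammingDist_triangle (α a) (α b) (α c)
    have h2 := (hα.adj_iff _ _).1 h
    rw [SimpleGraph.Walk.length_cons]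
    omega

theorem dist_eq (hα : IsDaisyLabelling G α) (u v : V) :
    G.dist u v = hammingDist (α u) (α v) := by
  obtain ⟨p, hp⟩ := hα.exists_walk u v
  refine le_antisymm (hp ▸ SimpleGraph.dist_le p) ?_
  obtain ⟨q, hq⟩ := p.reachable.exists_walk_length_eq_dist
  exact hq ▸ hα.hammingDist_le_length q

theorem connected (hα : IsDaisyLabelling G α) [Nonempty V] : G.Connected :=
  ⟨fun u v => (hα.exists_walk u v).choose.reachable⟩

end IsDaisyLabelling

/-- The full cube is itself a lower set, labelled by the identity. -/
theorem hypercube_dist {h : ℕ} (x y : Fin h → Bool) :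
    (hypercube h).dist x y = hammingDist x y :=
  IsDaisyLabelling.dist_eq (α := id)
    ⟨Function.injective_id, fun _ _ => Iff.rfl, fun _ y _ => ⟨y, rfl⟩⟩ x y

/-! ### Vertices of maximum degree -/

theorem IsIsometricEmbedding.injective {V : Type*} {G : SimpleGraph V} (hG : G.Connected) {h : ℕ}
    {γ : V → (Fin h → Bool)} (hγ : IsIsometricEmbedding G γ) : Function.Injective γ := by
  intro a b hab
  have := hγ a b
  rw [hypercube_dist, hab, hammingDist_self] at this
  exact hG.dist_eq_zero_iff.1 this.symm

/-- Distinct neighbours of `u` are sent to flips of `γ u` in distinct positions. -/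
theorem IsIsometricEmbedding.degree_le {V : Type*} [Fintype V] {G : SimpleGraph V}
    [DecidableRel G.Adj] (hG : G.Connected) {h : ℕ}
    {γ : V → (Fin h → Bool)} (hγ : IsIsometricEmbedding G γ) (u : V) : G.degree u ≤ h := by
  have key : ∀ z : G.neighborSet u, ∃ i, γ z = flip (γ u) i := by
    rintro ⟨z, hz⟩
    rw [← hammingDist_eq_one_iff, ← hypercube_dist, hγ]
    exact SimpleGraph.dist_eq_one_iff_adj.2 hz
  choose f hf using key
  have hinj : Function.Injective f := by
    intro a b hab
    refine Subtype.ext (hγ.injective hG ?_)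
    rw [hf, hf, hab]
  have := Fintype.card_le_of_injective f hinj
  rwa [SimpleGraph.card_neighborSet_eq_degree, Fintype.card_fin] at this

namespace IsDaisyLabelling

variable {V : Type*} [Fintype V] {G : SimpleGraph V} [DecidableRel G.Adj]
  {k : ℕ} {α : V → (Fin k → Bool)}

/-- At a vertex of maximum degree, every position that is used at all can be flipped. -/
theorem flip_mem_of_max_degree (hα : IsDaisyLabelling G α) {u : V}
    (hu : ∀ v, G.degree v ≤ G.degree u) {v : V} {i : Fin k} (hi : α v i = true) :
    ∃ z, α z = flip (α u) i := by
  classical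
  -- From the zero word `o` every used position can be flipped up, so the set `U` of used positions
  -- satisfies `U.card ≤ G.degree o ≤ G.degree u`.
  obtain ⟨o, ho⟩ := hα.lower v (fun _ => false) (fun _ => Bool.false_le _)
  let U : Finset (Fin k) := {i | ∃ v, α v i = true}
  have hU : U.card ≤ G.degree u := by
    refine le_trans ?_ (hu o)
    have key : ∀ i : U, ∃ z, α z = flip (α o) i := by
      rintro ⟨i, hi⟩
      obtain ⟨v, hv⟩ := (Finset.mem_filter.1 hi).2
      exact hα.flip_up_mem (y := v) (by rw [ho]; exact fun _ => Bool.false_le _) hv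
    choose f hf using key
    have hinj : Function.Injective
        (fun i : U => (⟨f i, hα.adj_iff_flip.2 ⟨i, hf i⟩⟩ : G.neighborSet o)) := by
      intro a b hab
      have h1 : f a = f b := congrArg Subtype.val hab
      have h2 := hf a
      rw [h1, hf b] at h2
      exact Subtype.ext (flip_injective _ h2).symm
    have := Fintype.card_le_of_injective _ hinj
    rwa [SimpleGraph.card_neighborSet_eq_degree, Fintype.card_coe] at this
  -- Conversely each edge at `u` flips a used position. This injects the neighbours into `U`, and
  -- the cardinality bound makes the injection surjective.
  have key : ∀ z : G.neighborSet u, ∃ i : U, α z = flip (α u) i := by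
    rintro ⟨z, hz⟩
    obtain ⟨i, hi⟩ := hα.adj_iff_flip.1 hz
    refine ⟨⟨i, Finset.mem_filter.2 ⟨Finset.mem_univ _, ?_⟩⟩, hi⟩
    cases h : α u i
    · exact ⟨z, by rw [hi, flip_self, h]; rfl⟩
    · exact ⟨u, h⟩
  choose f hf using key
  have hinj : Function.Injective f := by
    intro a b hab
    exact Subtype.ext (hα.injective (by rw [hf, hf, hab]))
  have hsurj := (hinj.bijective_of_nat_card_le (by
    rwa [Nat.card_eq_fintype_card, Nat.card_eq_fintype_card,
      SimpleGraph.card_neighborSet_eq_degree, Fintype.card_coe])).2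
  obtain ⟨z, hz⟩ := hsurj ⟨i, Finset.mem_filter.2 ⟨Finset.mem_univ _, v, hi⟩⟩
  exact ⟨z, by rw [hf, hz]⟩

/-- A vertex other than `u` and its neighbours has two predecessors,
if `u` has maximum degree. -/
theorem exists_two_flips (hα : IsDaisyLabelling G α) {u : V}
    (hu : ∀ v, G.degree v ≤ G.degree u) {v : V} (hvu : v ≠ u) (hadj : ¬ G.Adj u v) :
    ∃ i j, i ≠ j ∧ α v i ≠ α u i ∧ α v j ≠ α u j ∧
      (∃ z, α z = flip (α v) i) ∧ ∃ z, α z = flip (α v) j := by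
  obtain ⟨a, b, hab, ha, hb⟩ : ∃ a b, a ≠ b ∧ α v a ≠ α u a ∧ α v b ≠ α u b := by
    have h1 : 1 < hammingDist (α v) (α u) := by
      have h0 : hammingDist (α v) (α u) ≠ 0 :=
        fun h => hvu (hα.injective (hammingDist_eq_zero.1 h))
      have h1 : hammingDist (α v) (α u) ≠ 1 :=
        fun h => hadj ((hα.adj_iff _ _).2 (by rwa [hammingDist_comm]))
      omega
    obtain ⟨a, ha, b, hb, hab⟩ := Finset.one_lt_card.1 h1
    exact ⟨a, b, hab, by simpa using ha, by simpa using hb⟩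
  -- With two ones of `v` outside `u`, both can simply be erased.
  by_cases h2 : ∃ i j, i ≠ j ∧ (α v i = true ∧ α u i = false) ∧ (α v j = true ∧ α u j = false)
  · obtain ⟨i, j, hij, hi, hj⟩ := h2
    exact ⟨i, j, hij, by simp [hi], by simp [hj], hα.flip_down_mem hi.1, hα.flip_down_mem hj.1⟩
  -- Otherwise a vertex `y` above both `v` and the missing ones of `u` is enough: below it, every
  -- position where `v` and `u` differ can be flipped, either down or up.
  suffices ∃ y, α v ≤ α y ∧ ∀ i, α v i = false → α u i = true → α y i = true by
    obtain ⟨y, hvy, hy⟩ := this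
    have key : ∀ i, α v i ≠ α u i → ∃ z, α z = flip (α v) i := by
      intro i hi
      cases h : α v i
      · exact hα.flip_up_mem hvy (hy i h (by simpa [h] using hi))
      · exact hα.flip_down_mem h
    exact ⟨a, b, hab, ha, hb, key a ha, key b hb⟩
  -- At most one one of `v` lies outside `u`. If there is such a position `i`, then `y` is `u` with
  -- `i` flipped up, which exists by maximality of the degree; if there is none, `y` is `u` itself.
  by_cases h1 : ∃ i, α v i = true ∧ α u i = false
  · obtain ⟨i, hi⟩ := h1
    obtain ⟨y, hy⟩ := hα.flip_mem_of_max_degree hu hi.1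
    refine ⟨y, fun j => ?_, fun j hvj huj => ?_⟩
    · by_cases hj : j = i
      · subst hj; rw [hy, flip_self, hi.2]; exact Bool.le_true _
      · rw [hy, flip_of_ne _ hj]
        cases hvj : α v j
        · exact Bool.false_le _
        · cases huj : α u j
          · exact absurd ⟨j, i, hj, ⟨hvj, huj⟩, hi⟩ h2
          · exact le_rfl
    · by_cases hj : j = i
      · subst hj; rw [hi.1] at hvj; simp at hvj
      · rw [hy, flip_of_ne _ hj, huj]
  · refine ⟨u, fun j => ?_, fun _ _ h => h⟩
    cases hvj : α v j
    · exact Bool.false_le _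
    · cases huj : α u j
      · exact absurd ⟨j, hvj, huj⟩ h1
      · exact le_rfl

end IsDaisyLabelling

/-- `β` is an isometric embedding whose origin is `u`, in which the `i`-th neighbour of `u` gets the
`i`-th unit word, and in which every other vertex has enough predecessors to determine its word. -/
structure IsRootedLabelling {V : Type*} (G : SimpleGraph V) (u : V) {h : ℕ}
    (e : Fin h ≃ G.neighborSet u) (β : V → (Fin h → Bool)) : Prop where
  isometric : IsIsometricEmbedding G β
  root : β u = fun _ => false
  neighbours : ∀ i, β (e i) = unitWord i
  predecessor_le : ∀ v, ∀ z ∈ predecessors G u v, β z ≤ β v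
  later : ∀ v, v ≠ u → ¬ G.Adj u v →
    ∃ z ∈ predecessors G u v, ∃ z' ∈ predecessors G u v, z ≠ z' ∧
      β v = fun i => β z i || β z' i

/-- Translating by `α u` moves `u` to the origin. The directions of the edges at `u` cover every
position in which two vertices can differ, so restricting to them loses no distance. -/
theorem IsDaisyLabelling.exists_rooted {V : Type*} [Fintype V] {G : SimpleGraph V}
    [DecidableRel G.Adj] {k : ℕ} {α : V → (Fin k → Bool)} (hα : IsDaisyLabelling G α) {u : V}
    (hu : ∀ v, G.degree v ≤ G.degree u) {h : ℕ} (e : Fin h ≃ G.neighborSet u) :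
    ∃ β : V → (Fin h → Bool), IsRootedLabelling G u e β := by
  have key : ∀ i, ∃ c, α (e i) = flip (α u) c := fun i => hα.adj_iff_flip.1 (e i).2
  choose dir hdir using key
  have hinj : Function.Injective dir := by
    intro a b hab
    exact e.injective (Subtype.ext (hα.injective (by rw [hdir, hdir, hab])))
  have hrange : ∀ v c, α v c = true → ∃ i, dir i = c := by
    intro v c hc
    obtain ⟨z, hz⟩ := hα.flip_mem_of_max_degree hu hc
    refine ⟨e.symm ⟨z, hα.adj_iff_flip.2 ⟨c, hz⟩⟩, flip_injective (α u) ?_⟩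
    rw [← hdir, ← hz]
    simp
  have hrange' : ∀ v z c, α v c ≠ α z c → ∃ i, dir i = c := by
    intro v z c hc
    cases h1 : α v c
    · exact hrange z c (by simpa [h1] using hc)
    · exact hrange v c h1
  -- Correcting a position in which `v` differs from `u` lowers the distance to `u` by one.
  have hpred : ∀ v c z, α v c ≠ α u c → α z = flip (α v) c → z ∈ predecessors G u v := by
    intro v c z hc hz
    refine ⟨hα.adj_iff_flip.2 ⟨c, hz⟩, ?_⟩
    rw [hα.dist_eq, hα.dist_eq, hammingDist_comm, hammingDist_comm (α u), hz,
      hammingDist_flip_of_ne hc]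
  refine ⟨fun v i => xor (α v (dir i)) (α u (dir i)), ?_, ?_, ?_, ?_, ?_⟩
  · intro v z
    rw [hypercube_dist, hα.dist_eq]
    unfold hammingDist
    refine Finset.card_bij (fun i _ => dir i) ?_ (fun _ _ _ _ h => hinj h) ?_
    · intro i hi
      simpa using hi
    · intro c hc
      obtain ⟨i, rfl⟩ := hrange' v z c (by simpa using hc)
      exact ⟨i, by simpa using hc, rfl⟩
  · funext i; simp
  · intro i
    funext j
    by_cases hj : j = i
    · subst hj; simp [hdir, flip_self, unitWord]
    · simp [hdir, flip_of_ne _ (hinj.ne hj), unitWord, hj]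
  · rintro v z ⟨hadj, hd⟩ i
    obtain ⟨c, hc⟩ := hα.adj_iff_flip.1 hadj
    -- The edge to a predecessor corrects a position where `v` differs from `u`, so in the
    -- translated words it erases a one.
    have hne : α v c ≠ α u c := by
      intro heq
      have := hammingDist_flip_of_eq heq
      rw [hα.dist_eq, hα.dist_eq, hammingDist_comm, hammingDist_comm (α u), hc] at hd
      omega
    by_cases hi : dir i = c
    · subst hi
      simp only [hc, flip_self]
      cases h1 : α v (dir i) <;> cases h2 : α u (dir i) <;> simp_all
    · simp [hc, flip_of_ne _ hi]
  · intro v hvu hadj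
    -- The translated words of `z` and `z'` lack one different one each, so their OR restores both.
    obtain ⟨c, c', hne, hc, hc', ⟨z, hz⟩, ⟨z', hz'⟩⟩ := hα.exists_two_flips hu hvu hadj
    refine ⟨z, hpred v c z hc hz, z', hpred v c' z' hc' hz', ?_, ?_⟩
    · rintro rfl
      exact hne (flip_injective (α v) (hz.symm.trans hz'))
    · funext i
      by_cases hi : dir i = c
      · subst hi
        simp only [hz, hz', flip_self, flip_of_ne _ hne]
        cases h1 : α v (dir i) <;> cases h2 : α u (dir i) <;> simp_all
      · by_cases hi' : dir i = c'
        · subst hi'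
          simp only [hz, hz', flip_self, flip_of_ne _ hi]
          cases h1 : α v (dir i) <;> cases h2 : α u (dir i) <;> simp_all
        · simp [hz, hz', flip_of_ne _ hi, flip_of_ne _ hi']

/-- The maximum degree of a daisy cube is its isometric dimension. -/
theorem IsDaisyLabelling.degree_eq_dimension {V : Type*} [Fintype V] {G : SimpleGraph V}
    [DecidableRel G.Adj] {k : ℕ} {α : V → (Fin k → Bool)} (hα : IsDaisyLabelling G α) {u : V}
    (hu : ∀ v, G.degree v ≤ G.degree u) {h : ℕ} (hh : IsIsometricDimension G h) :
    G.degree u = h := by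
  have : Nonempty V := ⟨u⟩
  obtain ⟨⟨γ, hγ⟩, hmin⟩ := hh
  refine le_antisymm (hγ.degree_le hα.connected u) ?_
  obtain ⟨e⟩ : Nonempty (Fin (G.degree u) ≃ G.neighborSet u) :=
    ⟨(Fintype.equivFinOfCardEq (SimpleGraph.card_neighborSet_eq_degree G u)).symm⟩
  obtain ⟨β, hβ⟩ := hα.exists_rooted hu e
  exact hmin ⟨β, hβ.isometric⟩

/-- Adjacent vertices are at different distances from `u`. -/
theorem IsDaisyLabelling.dist_ne {V : Type*} {G : SimpleGraph V}
    {k : ℕ} {α : V → (Fin k → Bool)} (hα : IsDaisyLabelling G α) (u : V) {v z : V}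
    (h : G.Adj v z) : G.dist u v ≠ G.dist u z := by
  obtain ⟨c, hc⟩ := hα.adj_iff_flip.1 h
  rw [hα.dist_eq, hα.dist_eq, hammingDist_comm, hammingDist_comm (α u), hc]
  by_cases hvc : α v c = α u c
  · have := hammingDist_flip_of_eq hvc
    omega
  · have := hammingDist_flip_of_ne hvc
    omega

/-! ### Breadth-first orders -/

/-- The proof shows by induction on `m` that vertices at distance at most `m` from `u` precede all
those farther away. -/
theorem IsBFSOrder.lt_of_dist_lt {n : ℕ} {G : SimpleGraph (Fin n)} (hG : G.Connected) {u : Fin n}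
    {σ : Equiv.Perm (Fin n)} (hσ : IsBFSOrder G u σ) {b c : Fin n}
    (h : G.dist u (σ b) < G.dist u (σ c)) : b < c := by
  obtain ⟨h0, h3⟩ := hσ
  suffices ∀ m, ∀ b c, G.dist u (σ b) ≤ m → m < G.dist u (σ c) → b < c from
    this _ b c le_rfl h
  intro m
  induction m with
  | zero =>
    intro b c hb hc
    have hub : u = σ b := hG.dist_eq_zero_iff.1 (Nat.le_zero.1 hb)
    have hbc : b ≠ c := by rintro rfl; omega
    have hb0 : (b : ℕ) = 0 := by rw [← h0, hub, Equiv.symm_apply_apply]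
    rw [Fin.lt_def]
    have : (b : ℕ) ≠ c := fun h => hbc (Fin.ext h)
    omega
  | succ m ih =>
    intro b c hb hc
    rcases Nat.lt_or_ge m (G.dist u (σ b)) with hmb | hmb
    · have hbc : b ≠ c := by rintro rfl; omega
      by_contra hlt
      have hcb : c < b := lt_of_le_of_ne (not_lt.1 hlt) hbc.symm
      obtain ⟨z, hz, hzd⟩ : ∃ z, G.Adj z (σ b) ∧ G.dist u z ≤ m := by
        obtain ⟨p, hp⟩ := hG.exists_walk_length_eq_dist (σ b) u
        rw [SimpleGraph.dist_comm] at hp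
        cases p with
        | nil => rw [SimpleGraph.dist_self] at hmb; omega
        | cons hz q =>
          rename_i z
          refine ⟨z, hz.symm, ?_⟩
          have := SimpleGraph.dist_le q
          rw [SimpleGraph.dist_comm] at this
          rw [SimpleGraph.Walk.length_cons] at hp
          omega
      obtain ⟨a, rfl⟩ := σ.surjective z
      have hfar : ∀ d, G.Adj (σ d) (σ c) → m < G.dist u (σ d) := by
        intro d hd
        have := hG.dist_triangle (u := u) (v := σ d) (w := σ c)
        rw [SimpleGraph.dist_eq_one_iff_adj.2 hd] at this
        omega
      -- Suppose `c` came before `b`. The neighbour `a` of `b` at distance at most `m` precedes `c`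
      -- and is not adjacent to it, so the order condition yields a neighbour `d` of `c` before `a`.
      -- But `d` is farther than `m`, so by induction it comes after `a`.
      obtain ⟨d, hda, hd⟩ := h3 a c b (ih a c hzd (by omega)) hcb hz
        (fun hac => absurd (hfar a hac) (not_lt.2 hzd))
      exact absurd (ih a d hzd (hfar d hd)) (not_lt.2 hda.le)
    · exact ih b c hmb (by omega)

end Daisy

namespace Daisy

/-! ### Breadth-first search, abstractly -/

/-- A stage of a breadth-first search from `u`: `q 0, …, q (t - 1)` have been visited in this order,
and the neighbours of `q 0, …, q (i - 1)` have all been visited. -/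
structure BFSState {n : ℕ} (G : SimpleGraph (Fin n)) (u : Fin n) (q : ℕ → Fin n) (i t : ℕ) :
    Prop where
  pos : 0 < t
  head_le : i ≤ t
  root : q 0 = u
  inj : ∀ a b, a < t → b < t → q a = q b → a = b
  parent : ∀ b, 0 < b → b < t → ∃ d ≤ i, G.Adj (q d) (q b)
  closed : ∀ a < i, ∀ z, G.Adj (q a) z → ∃ b < t, q b = z
  three : ∀ a b c, a < b → b < c → c < t → G.Adj (q a) (q c) → ¬ G.Adj (q a) (q b) →
    ∃ d < a, G.Adj (q d) (q b)

namespace BFSState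

variable {n : ℕ} {G : SimpleGraph (Fin n)} {u : Fin n} {q : ℕ → Fin n} {i t : ℕ}

theorem start (G : SimpleGraph (Fin n)) (u : Fin n) : BFSState G u (fun _ => u) 0 1 where
  pos := Nat.one_pos
  head_le := Nat.zero_le _
  root := rfl
  inj a b ha hb _ := by omega
  parent b h0 h1 := by omega
  closed a ha := by omega
  three a b c hab hbc hc := by omega

/-- Only the order condition with the new vertex `z` in last place needs an argument. A neighbour `q
a` of `z` has `a ≥ i`, since earlier neighbourhoods are already visited. The parent of `q b` has
index at most `i`, and this index is not `a`, as `q a` is not adjacent to `q b`. -/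
theorem push (hq : BFSState G u q i t) (hi : i < t) {z : Fin n} (hz : G.Adj (q i) z)
    (hnew : ∀ b < t, q b ≠ z) : BFSState G u (Function.update q t z) i (t + 1) := by
  have hold : ∀ a, a < t → Function.update q t z a = q a := fun a ha =>
    Function.update_of_ne ha.ne _ _
  have hself : Function.update q t z t = z := Function.update_self _ _ _
  refine ⟨by omega, by omega, ?_, ?_, ?_, ?_, ?_⟩
  · rw [hold 0 hq.pos, hq.root]
  · intro a b ha hb hab
    rcases Nat.lt_succ_iff_lt_or_eq.1 ha with ha | rfl <;>
      rcases Nat.lt_succ_iff_lt_or_eq.1 hb with hb | rfl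
    · rw [hold a ha, hold b hb] at hab
      exact hq.inj a b ha hb hab
    · rw [hold a ha, hself] at hab
      exact absurd hab (hnew a ha)
    · rw [hold b hb, hself] at hab
      exact absurd hab.symm (hnew b hb)
    · rfl
  · intro b h0 hb
    rcases Nat.lt_succ_iff_lt_or_eq.1 hb with hb | rfl
    · obtain ⟨d, hd, hadj⟩ := hq.parent b h0 hb
      exact ⟨d, hd, by rwa [hold d (by omega), hold b hb]⟩
    · exact ⟨i, le_rfl, by rwa [hold i hi, hself]⟩
  · intro a ha y hy
    rw [hold a (by omega)] at hy
    obtain ⟨b, hb, rfl⟩ := hq.closed a ha y hy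
    exact ⟨b, by omega, hold b hb⟩
  · intro a b c hab hbc hc hac hnab
    rw [hold a (by omega)] at hac hnab
    rw [hold b (by omega)] at hnab ⊢
    suffices ∃ d < a, G.Adj (q d) (q b) by
      obtain ⟨d, hd, hadj⟩ := this
      exact ⟨d, hd, by rwa [hold d (by omega)]⟩
    rcases Nat.lt_succ_iff_lt_or_eq.1 hc with hc | rfl
    · rw [hold c hc] at hac
      exact hq.three a b c hab hbc hc hac hnab
    · rw [hself] at hac
      have hia : i ≤ a := by
        by_contra hlt
        obtain ⟨b', hb', h⟩ := hq.closed a (by omega) z hac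
        exact hnew b' hb' h
      obtain ⟨d, hd, hadj⟩ := hq.parent b (by omega) hbc
      refine ⟨d, lt_of_le_of_ne (hd.trans hia) ?_, hadj⟩
      rintro rfl
      exact hnab hadj

theorem advance (hq : BFSState G u q i t) (hi : i < t)
    (hall : ∀ z, G.Adj (q i) z → ∃ b < t, q b = z) : BFSState G u q (i + 1) t where
  pos := hq.pos
  head_le := hi
  root := hq.root
  inj := hq.inj
  parent b h0 hb := by
    obtain ⟨d, hd, h⟩ := hq.parent b h0 hb
    exact ⟨d, by omega, h⟩
  closed a ha := by
    rcases Nat.lt_succ_iff_lt_or_eq.1 ha with ha | rfl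
    · exact hq.closed a ha
    · exact hall
  three := hq.three

theorem le_card (hq : BFSState G u q i t) : t ≤ n := by
  have h := Fintype.card_le_of_injective (fun a : Fin t => q a)
    (fun a b hab => Fin.ext (hq.inj a b a.2 b.2 hab))
  simpa using h

/-- Once the head has reached the tail, the visited set contains `u` and is closed under adjacency,
so by connectedness it is everything. -/
theorem finish (hq : BFSState G u q t t) (hG : G.Connected) :
    t = n ∧ ∃ σ : Equiv.Perm (Fin n), (∀ a : Fin n, σ a = q a) ∧ IsBFSOrder G u σ := by
  have hmem : ∀ v, ∃ b < t, q b = v := by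
    intro v
    have key : ∀ x y, G.Walk x y → (∃ b < t, q b = x) → ∃ b < t, q b = y := by
      intro x y p
      induction p with
      | nil => exact id
      | cons h p ih =>
        rintro ⟨b, hb, rfl⟩
        exact ih (hq.closed b hb _ h)
    exact key u v (hG.preconnected u v).some ⟨0, hq.pos, hq.root⟩
  have ht : t = n := by
    refine le_antisymm hq.le_card ?_
    have h := Fintype.card_le_of_surjective (fun a : Fin t => q a)
      (fun v => let ⟨b, hb, h⟩ := hmem v; ⟨⟨b, hb⟩, h⟩)
    simpa using h
  subst ht
  have hinj : Function.Injective (fun a : Fin t => q a) :=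
    fun a b hab => Fin.ext (hq.inj a b a.2 b.2 hab)
  refine ⟨rfl, Equiv.ofBijective _ (Finite.injective_iff_bijective.1 hinj), fun a => rfl, ?_, ?_⟩
  · have : Equiv.ofBijective _ (Finite.injective_iff_bijective.1 hinj) ⟨0, hq.pos⟩ = u := hq.root
    rw [← this, Equiv.symm_apply_apply]
  · intro a b c hab hbc hac hnab
    obtain ⟨d, hd, h⟩ := hq.three a b c hab hbc c.2 hac hnab
    exact ⟨⟨d, by omega⟩, hd, h⟩

end BFSState

/-- Used to bound the cost of the search: no vertex is charged twice. -/
theorem sum_range_le_sum_univ {n t : ℕ} {q : ℕ → Fin n}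
    (hq : ∀ a b, a < t → b < t → q a = q b → a = b) (f : Fin n → ℕ) :
    ∑ j ∈ Finset.range t, f (q j) ≤ ∑ v, f v := by
  rw [← Finset.sum_image (f := f) (g := q) (s := Finset.range t)]
  · exact Finset.sum_le_sum_of_subset (Finset.subset_univ _)
  · intro a ha b hb hab
    exact hq a b (by simpa using ha) (by simpa using hb) hab

/-- The words of the labelling satisfy the recursion along a breadth-first order. -/
theorem IsRootedLabelling.apply_iff {n : ℕ} {G : SimpleGraph (Fin n)} (hG : G.Connected)
    {u : Fin n} (hne : ∀ v z, G.Adj v z → G.dist u v ≠ G.dist u z)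
    {σ : Equiv.Perm (Fin n)} (hσ : IsBFSOrder G u σ) {h : ℕ} {e : Fin h ≃ G.neighborSet u}
    {β : Fin n → (Fin h → Bool)} (hβ : IsRootedLabelling G u e β) (v : Fin n) (x : Fin h) :
    β v x = true ↔ ((v = u ∨ G.Adj u v) ∧ β v x = true) ∨
      ∃ z, G.Adj v z ∧ σ.symm z < σ.symm v ∧ β z x = true := by
  have hlt : ∀ z v, G.dist u z < G.dist u v → σ.symm z < σ.symm v := fun z v hd =>
    hσ.lt_of_dist_lt hG (by simpa using hd)
  constructor
  · intro hx
    by_cases hv : v = u ∨ G.Adj u v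
    · exact Or.inl ⟨hv, hx⟩
    · rw [not_or] at hv
      obtain ⟨z, hz, z', hz', -, heq⟩ := hβ.later v hv.1 hv.2
      rw [heq] at hx
      have hd := hz.2
      have hd' := hz'.2
      rcases Bool.or_eq_true_iff.1 hx with hx | hx
      · exact Or.inr ⟨z, hz.1, hlt _ _ (by omega), hx⟩
      · exact Or.inr ⟨z', hz'.1, hlt _ _ (by omega), hx⟩
  · rintro (⟨-, hx⟩ | ⟨z, hz, hzv, hx⟩)
    · exact hx
    -- An earlier neighbour is not farther from `u`, and adjacent vertices are never equally far, so
    -- `z` is a predecessor and its word lies below that of `v`.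
    · have h1 : G.dist u z ≤ G.dist u v := by
        by_contra hlt'
        exact absurd (hlt v z (not_le.1 hlt')) (not_lt.2 hzv.le)
      have h2 := hne v z hz
      have h3 := hG.dist_triangle (u := u) (v := z) (w := v)
      rw [SimpleGraph.dist_eq_one_iff_adj.2 hz.symm] at h3
      have h4 := hβ.predecessor_le v z ⟨hz, by omega⟩ x
      rw [hx] at h4
      exact Bool.eq_true_of_true_le h4

/-! ### Terminating runs -/

/-- From `s`, the program `P` halts within `T` steps in a store that satisfies `Q`. -/
def Terminates (w : ℕ) (P : Prog) (s : Store) (T : ℕ) (Q : Store → Prop) : Prop :=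
  ∃ t s', Exec w P s t s' ∧ t ≤ T ∧ Q s'

section StoreLemmas

variable (s : Store) (x y k a b i : ℕ)

@[simp] theorem Store.reg_setReg : (s.setReg x k).reg y = if y = x then k else s.reg y := by
  simp [Store.setReg, Function.update_apply]

@[simp] theorem Store.arr_setReg : (s.setReg x k).arr = s.arr := rfl

@[simp] theorem Store.reg_setArr : (s.setArr a i k).reg = s.reg := rfl

@[simp] theorem Store.arr_setArr :
    (s.setArr a i k).arr b = if b = a then Function.update (s.arr a) i k else s.arr b := by
  simp [Store.setArr, Function.update_apply]

end StoreLemmas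

namespace Terminates

variable {w x y z k a : ℕ} {s : Store} {P P' : Prog} {T T' : ℕ} {Q R : Store → Prop}

theorem mono (h : Terminates w P s T Q) (hT : T ≤ T') (hQ : ∀ s', Q s' → R s') :
    Terminates w P s T' R := by
  obtain ⟨t, s', he, ht, hq⟩ := h
  exact ⟨t, s', he, ht.trans hT, hQ s' hq⟩

theorem mono_time (h : Terminates w P s T Q) (hT : T ≤ T') : Terminates w P s T' Q :=
  h.mono hT fun _ => id

theorem const (hk : k < 2 ^ w) (h : Q (s.setReg x k)) : Terminates w (.const x k) s 1 Q :=
  ⟨1, _, .const s x k hk, le_rfl, h⟩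

theorem add (hk : s.reg y + s.reg z < 2 ^ w) (h : Q (s.setReg x (s.reg y + s.reg z))) :
    Terminates w (.add x y z) s 1 Q :=
  ⟨1, _, .add s x y z hk, le_rfl, h⟩

theorem sub (hk : s.reg y - s.reg z < 2 ^ w) (h : Q (s.setReg x (s.reg y - s.reg z))) :
    Terminates w (.sub x y z) s 1 Q :=
  ⟨1, _, .sub s x y z hk, le_rfl, h⟩

theorem bitOr (hk : s.reg y ||| s.reg z < 2 ^ w) (h : Q (s.setReg x (s.reg y ||| s.reg z))) :
    Terminates w (.bitOr x y z) s 1 Q :=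
  ⟨1, _, .bitOr s x y z hk, le_rfl, h⟩

theorem load (hk : s.arr a (s.reg y) < 2 ^ w) (h : Q (s.setReg x (s.arr a (s.reg y)))) :
    Terminates w (.load x a y) s 1 Q :=
  ⟨1, _, .load s x a y hk, le_rfl, h⟩

theorem store (hk : s.reg y < 2 ^ w) (h : Q (s.setArr a (s.reg x) (s.reg y))) :
    Terminates w (.store a x y) s 1 Q :=
  ⟨1, _, .store s a x y hk, le_rfl, h⟩

theorem seq (h : Terminates w P s T fun s' => Terminates w P' s' T' Q) :
    Terminates w (.seq P P') s (T + T') Q := by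
  obtain ⟨t, s', he, ht, t', s'', he', ht', hq⟩ := h
  exact ⟨t + t', s'', .seq he he', Nat.add_le_add ht ht', hq⟩

theorem ifLt (ht : s.reg x < s.reg y → Terminates w P s T Q)
    (hf : ¬ s.reg x < s.reg y → Terminates w P' s T Q) :
    Terminates w (.ifLt x y P P') s (T + 1) Q := by
  by_cases hxy : s.reg x < s.reg y
  · obtain ⟨t, s', he, ht, hq⟩ := ht hxy
    exact ⟨t + 1, s', .ifLt_true hxy he, by omega, hq⟩
  · obtain ⟨t, s', he, ht, hq⟩ := hf hxy
    exact ⟨t + 1, s', .ifLt_false hxy he, by omega, hq⟩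

/-- Rule for loops; the first argument of the invariant is the number of steps still allowed. -/
theorem whileLt {I : ℕ → Store → Prop}
    (step : ∀ B s, I B s → s.reg x < s.reg y →
      ∃ T B', T + 1 + B' ≤ B ∧ Terminates w P s T (I B'))
    {B : ℕ} (h : I B s) :
    Terminates w (.whileLt x y P) s (B + 1)
      (fun s' => (∃ B', I B' s') ∧ ¬ s'.reg x < s'.reg y) := by
  induction B using Nat.strong_induction_on generalizing s with
  | _ B ih =>
    by_cases hxy : s.reg x < s.reg y
    · obtain ⟨T, B', hB, t, s', he, ht, hI⟩ := step B s h hxy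
      obtain ⟨t', s'', he', ht', hq⟩ := ih B' (by omega) hI
      exact ⟨t + t' + 1, s'', .whileLt_true hxy he he', by omega, hq⟩
    · exact ⟨1, s, .whileLt_false hxy, by omega, ⟨B, h⟩, hxy⟩

end Terminates

end Daisy

namespace Daisy

/-! ### The program -/

infixr:60 ";;" => Prog.seq

/-- Run `body` with register `10` ranging over the adjacency list of the vertex in register `7`. -/
def scan (body : Prog) : Prog :=
  .load 8 0 7 ;; .add 9 7 4 ;; .load 9 0 9 ;;
    .whileLt 8 9 (.load 10 1 8 ;; body ;; .add 8 8 4)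

/-- Find a vertex of maximum degree (register `2`) and its degree (register `1`);
mark every vertex as not visited (array `4`) and clear all labels (array `2`). -/
def findRoot : Prog :=
  .const 3 0 ;; .const 4 1 ;; .const 1 0 ;; .const 2 0 ;; .const 5 0 ;;
    .whileLt 5 0
      (.store 4 5 0 ;; .store 2 5 3 ;; .load 6 0 5 ;; .add 5 5 4 ;; .load 7 0 5 ;; .sub 7 7 6 ;;
        .ifLt 1 7 (.add 1 7 3 ;; .sub 2 5 4) (.const 8 0))

/-- Breadth-first search: array `3` is the queue, array `4` holds the positions in the queue,
register `5` points to its head and register `6` behind its last element. -/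
def search : Prog :=
  .const 5 0 ;; .const 6 1 ;; .store 3 5 2 ;; .store 4 2 5 ;;
    .whileLt 5 6
      (.load 7 3 5 ;;
        scan (.load 11 4 10 ;;
          .ifLt 11 0 (.const 11 0) (.store 3 6 10 ;; .store 4 10 6 ;; .add 6 6 4)) ;;
        .add 5 5 4)

/-- Label the neighbours of the root by unit words. -/
def labelNeighbours : Prog :=
  .add 7 2 3 ;; .const 6 1 ;; scan (.store 2 10 6 ;; .add 6 6 6)

/-- Along the breadth-first order, join to the label of each vertex those of its earlier
neighbours. -/
def propagate : Prog :=
  .const 5 0 ;;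
    .whileLt 5 0
      (.load 7 3 5 ;; .load 12 2 7 ;;
        scan (.load 11 4 10 ;; .ifLt 11 5 (.load 11 2 10 ;; .bitOr 12 12 11) (.const 11 0)) ;;
        .store 2 7 12 ;; .add 5 5 4)

/-! ### Its verification -/

/-- The input and the constants `0` and `1` are in their places. -/
structure Input (n : ℕ) (off nb : ℕ → ℕ) (s : Store) : Prop where
  size : s.reg 0 = n
  zero : s.reg 3 = 0
  one : s.reg 4 = 1
  offsets : s.arr 0 = off
  entries : s.arr 1 = nb

/-- `off` and `nb` encode the adjacency lists `adj`, and all addresses fit in words of `w` bits. -/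
structure IsEncoding {n : ℕ} (w : ℕ) (adj : Fin n → List (Fin n)) (off nb : ℕ → ℕ) : Prop where
  next : ∀ v : Fin n, off ((v : ℕ) + 1) = off v + (adj v).length
  entry : ∀ (v : Fin n) (j : ℕ) (hj : j < (adj v).length), nb (off v + j) = ((adj v)[j] : Fin n)
  off_lt : ∀ v : Fin n, off v + (adj v).length + 1 < 2 ^ w
  size_lt : n + 1 < 2 ^ w

section

variable {n w : ℕ} {adj : Fin n → List (Fin n)} {off nb : ℕ → ℕ} {s : Store}

theorem Input.setReg (hs : Input n off nb s) {x : ℕ} (k : ℕ) (h0 : x ≠ 0) (h3 : x ≠ 3)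
    (h4 : x ≠ 4) : Input n off nb (s.setReg x k) where
  size := by rw [Store.reg_setReg, if_neg h0.symm, hs.size]
  zero := by rw [Store.reg_setReg, if_neg h3.symm, hs.zero]
  one := by rw [Store.reg_setReg, if_neg h4.symm, hs.one]
  offsets := hs.offsets
  entries := hs.entries

/-- Proof rule for `scan`: `J j` is the invariant after `j` entries, and it may not depend on the
registers `8`, `9`, `10` used by the scan itself. Each entry costs `T` for the body and three for
the test, load and increment; the constant four is the setup and the final failing test. -/
theorem terminates_scan (hA : IsEncoding w adj off nb) (hs : Input n off nb s) {v : Fin n}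
    (hv : s.reg 7 = v) {body : Prog} {T : ℕ} {J : ℕ → Store → Prop}
    (hJ : ∀ j s x k, x = 8 ∨ x = 9 ∨ x = 10 → J j s → J j (s.setReg x k))
    (hbody : ∀ j (hj : j < (adj v).length) s, Input n off nb s → J j s →
      s.reg 10 = ((adj v)[j] : Fin n) → Terminates w body s T fun s' =>
        Input n off nb s' ∧ J (j + 1) s' ∧ s'.reg 8 = s.reg 8 ∧ s'.reg 9 = s.reg 9)
    (h0 : J 0 s) :
    Terminates w (scan body) s ((T + 3) * (adj v).length + 4)
      (fun s' => Input n off nb s' ∧ J (adj v).length s') := by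
  have hv' := v.2
  have hlt := hA.off_lt v
  have hsz := hA.size_lt
  unfold scan
  refine Terminates.mono_time (.seq (.load ?_ (.seq (.add ?_ (.seq (.load ?_ (Terminates.mono
    (Terminates.whileLt (I := fun B s => ∃ j, Input n off nb s ∧ J j s ∧ j ≤ (adj v).length ∧
      s.reg 8 = off v + j ∧ s.reg 9 = off v + (adj v).length ∧
      B = (T + 3) * ((adj v).length - j)) ?_ ⟨0, ?_, ?_, ?_, ?_, ?_, rfl⟩) le_rfl ?_))))))) ?_
  all_goals try simp only [hs.offsets, hs.one, hv, Store.reg_setReg, Store.arr_setReg, if_true,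
    if_false, Nat.reduceEqDiff, hA.next]
  · omega
  · omega
  · omega
  · rintro B s ⟨j, hs, hj, hle, h8, h9, rfl⟩ hlt'
    have hj' : j < (adj v).length := by omega
    have he := hA.entry v j hj'
    refine ⟨1 + (T + 1), (T + 3) * ((adj v).length - (j + 1)), ?_,
      .seq (.load ?_ (.seq (Terminates.mono (hbody j hj' _ (hs.setReg _ ?_ ?_ ?_)
        (hJ _ _ _ _ ?_ hj) ?_) le_rfl ?_)))⟩
    · have : (adj v).length - j = (adj v).length - (j + 1) + 1 := by omega
      rw [this, Nat.mul_add, Nat.mul_one]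
      omega
    · rw [hs.entries, h8, he]
      have := ((adj v)[j]).2
      omega
    · decide
    · decide
    · decide
    · decide
    · rw [hs.entries, h8, he]; simp
    · rintro s' ⟨hs', hj1, h8', h9'⟩
      simp only [Store.reg_setReg, Nat.reduceEqDiff, if_false] at h8' h9'
      refine .add ?_ ⟨j + 1, hs'.setReg _ (by decide) (by decide) (by decide),
        hJ _ _ _ _ (by decide) hj1, hj', ?_, ?_, rfl⟩
      · rw [h8', hs'.one]; omega
      · simp [h8', hs'.one, h8, Nat.add_assoc]
      · simp [h9', h9]
  · exact ((hs.setReg _ (by decide) (by decide) (by decide)).setReg _ (by decide) (by decide)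
      (by decide)).setReg _ (by decide) (by decide) (by decide)
  · exact hJ _ _ _ _ (by decide) (hJ _ _ _ _ (by decide) (hJ _ _ _ _ (by decide) h0))
  · omega
  · rfl
  · rintro s' ⟨⟨B, j, hs', hj, hle, h8, h9, -⟩, hnlt⟩
    obtain rfl : j = (adj v).length := by omega
    exact ⟨hs', hj⟩
  · rw [Nat.sub_zero]; omega

theorem terminates_findRoot (hA : IsEncoding w adj off nb) (hn : 0 < n) (h0 : s.reg 0 = n)
    (hoff : s.arr 0 = off) (hnb : s.arr 1 = nb) :
    Terminates w findRoot s (10 * n + 6) (fun s' => Input n off nb s' ∧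
      ∃ u : Fin n, s'.reg 2 = u ∧ s'.reg 1 = (adj u).length ∧
        (∀ v, (adj v).length ≤ (adj u).length) ∧ ∀ v : Fin n, s'.arr 4 v = n ∧ s'.arr 2 v = 0) := by
  have hsz := hA.size_lt
  unfold findRoot
  -- The invariant has only `≤` between register `1` and the degree of the candidate, because the
  -- initial candidate, vertex `0`, is paired with degree `0` before it is inspected. Equality
  -- follows at the end, when all vertices are covered.
  refine Terminates.mono_time (.seq (.const ?_ (.seq (.const ?_ (.seq (.const ?_ (.seq (.const ?_
    (.seq (.const ?_ (Terminates.mono (Terminates.whileLt (I := fun B s => ∃ i,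
      Input n off nb s ∧ i ≤ n ∧ s.reg 5 = i ∧ (∃ u : Fin n, s.reg 2 = u ∧
        s.reg 1 ≤ (adj u).length) ∧
      (∀ v : Fin n, v < i → (adj v).length ≤ s.reg 1 ∧ s.arr 4 v = n ∧ s.arr 2 v = 0) ∧
      B = 10 * (n - i)) ?_ ⟨0, ?_, ?_, ?_, ⟨⟨0, hn⟩, ?_⟩, ?_, rfl⟩) le_rfl ?_))))))))))) ?_
  · omega
  · omega
  · omega
  · omega
  · omega
  · rintro B s ⟨i, hs, hi, h5, ⟨u, h2, h1⟩, hv, rfl⟩ hlt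
    rw [h5, hs.size] at hlt
    have hoi := hA.off_lt ⟨i, hlt⟩
    have hnx := hA.next ⟨i, hlt⟩
    simp only at hoi hnx
    refine ⟨9, 10 * (n - (i + 1)), by omega, ?_⟩
    refine Terminates.mono_time (.seq (.store ?_ (.seq (.store ?_ (.seq (.load ?_ (.seq (.add ?_
      (.seq (.load ?_ (.seq (.sub ?_ (.ifLt (T := 2) (fun hl => .seq (.add ?_ (.sub ?_ ?_)))
        (fun hl => Terminates.mono_time (.const ?_ ?_) ?_)))))))))))))) ?_
    all_goals try simp only [hs.offsets, hs.one, hs.zero, hs.size, h5,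
      Store.reg_setReg, Store.arr_setReg, Store.reg_setArr, Store.arr_setArr, if_true, if_false,
      Nat.reduceEqDiff, hnx, OfNat.zero_ne_ofNat, OfNat.one_ne_ofNat,
      Nat.add_sub_cancel_left] at hl
    · rw [hs.size]; omega
    · rw [Store.reg_setArr, hs.zero]; omega
    · simp only [Store.reg_setArr, Store.arr_setArr, hs.offsets, h5]; simp; omega
    · simp [h5, hs.one]; omega
    · simp [h5, hs.one, hs.offsets, hnx]; omega
    · simp [h5, hs.one, hs.offsets, hnx]; omega
    · simp [h5, hs.one, hs.zero, hs.offsets, hnx]; omega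
    · simp [h5, hs.one]; omega
    · refine ⟨i + 1, by constructor <;> simp [hs.size, hs.zero, hs.one, hs.offsets, hs.entries],
        hlt, by simp [h5, hs.one], ⟨⟨i, hlt⟩, by simp [h5, hs.one],
        by simp [h5, hs.one, hs.zero, hs.offsets, hnx]⟩, ?_, rfl⟩
      intro v hvi
      have hcase : v = ⟨i, hlt⟩ ∨ (v : ℕ) < i := by
        rcases Nat.lt_succ_iff_lt_or_eq.1 hvi with h | h
        · exact Or.inr h
        · exact Or.inl (Fin.ext h)
      rcases hcase with rfl | hvi'
      · simp [h5, hs.one, hs.zero, hs.size, hs.offsets, hnx]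
      · have := hv v hvi'
        simp [h5, hs.one, hs.zero, hs.offsets, hnx, Function.update_of_ne hvi'.ne, this]
        omega
    · omega
    · refine ⟨i + 1, by constructor <;> simp [hs.size, hs.zero, hs.one, hs.offsets, hs.entries],
        hlt, by simp [h5, hs.one], ⟨u, by simp [h2], by simp [h1]⟩, ?_, rfl⟩
      intro v hvi
      have hcase : v = ⟨i, hlt⟩ ∨ (v : ℕ) < i := by
        rcases Nat.lt_succ_iff_lt_or_eq.1 hvi with h | h
        · exact Or.inr h
        · exact Or.inl (Fin.ext h)
      rcases hcase with rfl | hvi'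
      · simp [h5, hs.zero, hs.size, not_lt.1 hl]
      · have := hv v hvi'
        simp [h5, Function.update_of_ne hvi'.ne, this]
    · omega
    · omega
  · constructor <;> simp [h0, hoff, hnb]
  · omega
  · simp
  · simp
  · intro v hv; omega
  · rintro s' ⟨⟨B, i, hs, hi, h5, ⟨u, h2, h1⟩, hv, -⟩, hnlt⟩
    rw [h5, hs.size] at hnlt
    have hlen : s'.reg 1 = (adj u).length := le_antisymm h1 (hv u (by omega)).1
    exact ⟨hs, u, h2, hlen, fun v => hlen ▸ (hv v (by omega)).1, fun v => (hv v (by omega)).2⟩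
  · omega

/-- The store holds the queue `q 0, …, q (t - 1)` and the positions of its elements. -/
structure IsQueue (q : ℕ → Fin n) (t : ℕ) (s : Store) : Prop where
  tail : s.reg 6 = t
  order : ∀ i < t, s.arr 3 i = q i
  position : ∀ i < t, s.arr 4 (q i) = i
  unvisited : ∀ v : Fin n, (∀ b < t, q b ≠ v) → s.arr 4 v = n

/-- The value `n` in array `4` marks an unvisited vertex, so comparing the entry with `n` decides
membership in the queue in constant time. The old queue remains a prefix of the new one. -/
theorem terminates_visit (hA : IsEncoding w adj off nb) {G : SimpleGraph (Fin n)} {u z : Fin n}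
    {q : ℕ → Fin n} {i t : ℕ} (hq : BFSState G u q i t) (hi : i < t) (hz : G.Adj (q i) z)
    (hs : Input n off nb s) (hqs : IsQueue q t s) (h10 : s.reg 10 = z) :
    Terminates w (.load 11 4 10 ;;
          .ifLt 11 0 (.const 11 0) (.store 3 6 10 ;; .store 4 10 6 ;; .add 6 6 4)) s 5
      (fun s' => Input n off nb s' ∧ (∃ q' t', BFSState G u q' i t' ∧ IsQueue q' t' s' ∧
        t ≤ t' ∧ (∀ a < t, q' a = q a) ∧ ∃ b < t', q' b = z) ∧
        (∀ x, x ≠ 6 → x ≠ 11 → s'.reg x = s.reg x) ∧ s'.arr 2 = s.arr 2) := by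
  have hsz := hA.size_lt
  have htn := hq.le_card
  have hzn := z.2
  by_cases hmem : ∃ b < t, q b = z
  · obtain ⟨b, hb, rfl⟩ := hmem
    have hp := hqs.position b hb
    refine .mono_time (.seq (.load ?_ (.ifLt (T := 1) (fun _ => .const ?_ ⟨?_, ⟨q, t, hq, ?_,
      le_rfl, fun _ _ => rfl, b, hb, rfl⟩, ?_, ?_⟩) (fun h => absurd ?_ h)))) (by omega)
    · rw [h10, hp]; omega
    · omega
    · exact (hs.setReg _ (by decide) (by decide) (by decide)).setReg _ (by decide) (by decide)
        (by decide)
    · exact ⟨by simp [hqs.tail], by simpa using hqs.order, by simpa using hqs.position,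
        by simpa using hqs.unvisited⟩
    · intro x h6 h11; simp [h11]
    · rfl
    · simp [h10, hp, hs.size]; omega
  · have hnew : ∀ b < t, q b ≠ z := fun b hb h => hmem ⟨b, hb, h⟩
    have hp := hqs.unvisited z hnew
    have hpush := hq.push hi hz hnew
    have ht1 := hpush.le_card
    have hold : ∀ a, a < t → Function.update q t z a = q a := fun a ha =>
      Function.update_of_ne ha.ne _ _
    refine .mono_time (.seq (.load ?_ (.ifLt (T := 3) (fun h => absurd h ?_) (fun _ =>
      .seq (.store ?_ (.seq (.store ?_ (.add ?_ ⟨?_, ⟨Function.update q t z, t + 1, hpush, ?_,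
      by omega, hold, t, by omega, Function.update_self _ _ _⟩, ?_, ?_⟩)))))))) (by omega)
    · rw [h10, hp]; omega
    · simp [h10, hp, hs.size]
    · simp [h10]; omega
    · simp [hqs.tail]; omega
    · simp [hqs.tail, hs.one]; omega
    · constructor <;> simp [hs.size, hs.zero, hs.one, hs.offsets, hs.entries]
    · refine ⟨by simp [hqs.tail, hs.one], ?_, ?_, ?_⟩
      · intro a ha
        rcases Nat.lt_succ_iff_lt_or_eq.1 ha with ha | rfl
        · simp [hold a ha, hqs.tail, h10, Function.update_of_ne ha.ne, hqs.order a ha]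
        · simp [hqs.tail, h10]
      · intro a ha
        rcases Nat.lt_succ_iff_lt_or_eq.1 ha with ha | rfl
        · have hne : ((q a : Fin n) : ℕ) ≠ z := fun h => hnew a ha (Fin.ext h)
          simp [hold a ha, h10, Function.update_of_ne hne, hqs.position a ha]
        · simp [hqs.tail, h10]
      · intro v hv
        have hvz : (v : ℕ) ≠ z := fun h => hv t (by omega) (by
          rw [Function.update_self]; exact (Fin.ext h).symm)
        simp only [Store.arr_setReg, Store.arr_setArr, Store.reg_setArr, Store.reg_setReg, h10,
          if_true, Nat.reduceEqDiff, if_false, Function.update_of_ne hvz]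
        exact hqs.unvisited v fun b hb => hold b hb ▸ hv b (by omega)
    · intro x h6 h11; simp [h6, h11]
    · simp

theorem terminates_search (hA : IsEncoding w adj off nb) {G : SimpleGraph (Fin n)}
    (hadj : ∀ v z, z ∈ adj v ↔ G.Adj v z) (hG : G.Connected) {u : Fin n}
    (hs : Input n off nb s) (h2 : s.reg 2 = u) (h4 : ∀ v : Fin n, s.arr 4 v = n) :
    Terminates w search s (∑ v, (8 * (adj v).length + 7) + 5) (fun s' => Input n off nb s' ∧
      s'.reg 1 = s.reg 1 ∧ s'.reg 2 = u ∧ s'.arr 2 = s.arr 2 ∧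
      ∃ σ : Equiv.Perm (Fin n), IsBFSOrder G u σ ∧
        ∀ i : Fin n, s'.arr 3 i = σ i ∧ s'.arr 4 (σ i) = i) := by
  have hsz := hA.size_lt
  have hun := u.2
  have hsum : ∀ (q : ℕ → Fin n) i t, BFSState G u q i t → i < t →
      ∑ j ∈ Finset.range (i + 1), (8 * (adj (q j)).length + 7) ≤
        ∑ v, (8 * (adj v).length + 7) := by
    intro q i t hq hi
    exact sum_range_le_sum_univ (fun a b ha hb => hq.inj a b (by omega) (by omega))
      (fun v => 8 * (adj v).length + 7)
  unfold search
  -- Each dequeued vertex pays eight per entry (five for the visit, three for the scan) and seven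
  -- for overhead; the remaining budget `B` is what the vertices already processed have left of the
  -- total.
  refine .mono_time (.seq (.const ?_ (.seq (.const ?_ (.seq (.store ?_ (.seq (.store ?_
    (Terminates.mono (Terminates.whileLt (I := fun B s' => ∃ q i t, Input n off nb s' ∧
      BFSState G u q i t ∧ IsQueue q t s' ∧ s'.reg 5 = i ∧
      (s'.reg 1 = s.reg 1 ∧ s'.reg 2 = u ∧ s'.arr 2 = s.arr 2) ∧
      ∑ j ∈ Finset.range i, (8 * (adj (q j)).length + 7) + B =
        ∑ v, (8 * (adj v).length + 7)) (B := ∑ v, (8 * (adj v).length + 7)) ?_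
      ⟨fun _ => u, 0, 1, ?_, BFSState.start G u, ?_, ?_, ?_, ?_⟩) le_rfl ?_))))))))) ?_
  · omega
  · omega
  · simp [h2]; omega
  · simp
  · rintro B s' ⟨q, i, t, hs', hq, hqs, h5, ⟨h1', h2', harr⟩, hB⟩ hlt
    rw [h5, hqs.tail] at hlt
    have hstep := hsum q i t hq hlt
    rw [Finset.sum_range_succ] at hstep
    have hqi := (q i).2
    refine ⟨8 * (adj (q i)).length + 6, B - (8 * (adj (q i)).length + 7), by omega, ?_⟩
    refine .mono_time (.seq (.load ?_ (Terminates.seq (T' := 1)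
      (Terminates.mono (terminates_scan hA (v := q i) ?_ ?_
      (T := 5) (J := fun j s' => ∃ q' t', BFSState G u q' i t' ∧ IsQueue q' t' s' ∧ i < t' ∧
        (∀ a ≤ i, q' a = q a) ∧ s'.reg 5 = i ∧
        (s'.reg 1 = s.reg 1 ∧ s'.reg 2 = u ∧ s'.arr 2 = s.arr 2) ∧
        ∀ l (hl : l < (adj (q i)).length), l < j → ∃ b < t', q' b = (adj (q i))[l])
        ?_ ?_ ?_) le_rfl ?_)))) (le_of_eq ?_)
    · rw [h5, hqs.order i hlt]; omega
    · exact hs'.setReg _ (by decide) (by decide) (by decide)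
    · simp [h5, hqs.order i hlt]
    · rintro j s'' x k hx ⟨q', t', hq', hqs', hi, hag, h5', ⟨hr1, hr2, hr3⟩, hl⟩
      refine ⟨q', t', hq', ⟨?_, hqs'.order, hqs'.position, hqs'.unvisited⟩, hi, hag, ?_,
        ⟨?_, ?_, hr3⟩, hl⟩
      · rw [Store.reg_setReg, if_neg (by omega), hqs'.tail]
      · rw [Store.reg_setReg, if_neg (by omega), h5']
      · rw [Store.reg_setReg, if_neg (by omega), hr1]
      · rw [Store.reg_setReg, if_neg (by omega), hr2]
    · rintro j hj s'' hs'' ⟨q', t', hq', hqs', hi, hag, h5', ⟨hr1, hr2, hr3⟩, hl⟩ h10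
      have hz : G.Adj (q' i) (adj (q i))[j] := by
        rw [hag i le_rfl]
        exact (hadj _ _).1 (List.getElem_mem hj)
      refine (terminates_visit hA hq' hi hz hs'' hqs' h10).mono le_rfl ?_
      rintro s₁ ⟨hs₁, ⟨q₁, t₁, hq₁, hqs₁, ht₁, hag₁, hb⟩, hreg, harr₁⟩
      refine ⟨hs₁, ⟨q₁, t₁, hq₁, hqs₁, by omega, fun a ha => ?_, ?_, ⟨?_, ?_, ?_⟩, ?_⟩, ?_, ?_⟩
      · rw [hag₁ a (by omega), hag a ha]
      · rw [hreg 5 (by decide) (by decide), h5']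
      · rw [hreg 1 (by decide) (by decide), hr1]
      · rw [hreg 2 (by decide) (by decide), hr2]
      · rw [harr₁, hr3]
      · intro l hl' hlj
        rcases Nat.lt_succ_iff_lt_or_eq.1 hlj with hlj | rfl
        · obtain ⟨b, hb, h⟩ := hl l hl' hlj
          exact ⟨b, by omega, by rw [hag₁ b hb, h]⟩
        · exact hb
      · exact hreg 8 (by decide) (by decide)
      · exact hreg 9 (by decide) (by decide)
    · exact ⟨q, t, hq, ⟨by simp [hqs.tail], hqs.order, hqs.position, hqs.unvisited⟩, hlt,
        fun _ _ => rfl, by simp [h5], ⟨by simp [h1'], by simp [h2'], harr⟩,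
        fun l _ hl => absurd hl (Nat.not_lt_zero l)⟩
    · rintro s'' ⟨hs'', q', t', hq', hqs', hi, hag, h5', ⟨hr1, hr2, hr3⟩, hl⟩
      have htn := hq'.le_card
      refine .add ?_ ⟨q', i + 1, t', hs''.setReg _ (by decide) (by decide) (by decide),
        hq'.advance hi ?_, ⟨by simp [hqs'.tail], hqs'.order, hqs'.position, hqs'.unvisited⟩,
        by simp [h5', hs''.one], ⟨by simp [hr1], by simp [hr2], hr3⟩, ?_⟩
      · rw [h5', hs''.one]; omega
      -- Every neighbour of the head occurs in its list, so after the full scan all of them are in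
      -- the queue and the head may advance.
      · intro z hz
        rw [hag i le_rfl, ← hadj] at hz
        obtain ⟨l, hl', rfl⟩ := List.getElem_of_mem hz
        exact hl l hl' hl'
      · have : ∑ j ∈ Finset.range i, (8 * (adj (q' j)).length + 7) =
            ∑ j ∈ Finset.range i, (8 * (adj (q j)).length + 7) :=
          Finset.sum_congr rfl fun j hj => by rw [hag j (Finset.mem_range.1 hj).le]
        rw [Finset.sum_range_succ, this, hag i le_rfl]
        omega
    · omega
  · constructor <;> simp [hs.size, hs.zero, hs.one, hs.offsets, hs.entries]
  · refine ⟨by simp, ?_, ?_, ?_⟩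
    · intro i hi
      obtain rfl : i = 0 := by omega
      simp [h2]
    · intro i hi
      obtain rfl : i = 0 := by omega
      simp [h2]
    · intro v hv
      have hvu : (v : ℕ) ≠ u := fun h => hv 0 (by omega) (Fin.ext h).symm
      simp [h2, Function.update_of_ne hvu, h4 v]
  · simp
  · exact ⟨by simp, by simp [h2], by simp⟩
  · simp
  · rintro s' ⟨⟨B, q, i, t, hs', hq, hqs, h5, ⟨h1', h2', harr⟩, -⟩, hnlt⟩
    rw [h5, hqs.tail] at hnlt
    obtain rfl : i = t := le_antisymm hq.head_le (not_lt.1 hnlt)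
    obtain ⟨rfl, σ, hσ, hbfs⟩ := hq.finish hG
    refine ⟨hs', h1', h2', harr, σ, hbfs, fun a => ?_⟩
    rw [hσ]
    exact ⟨hqs.order a a.2, hqs.position a a.2⟩
  · omega

/-- Register `6` holds `2 ^ j` after `j` entries. The bound `hw` is needed for the doubling after
the last entry; `hnd` prevents a label from being overwritten. -/
theorem terminates_labelNeighbours (hA : IsEncoding w adj off nb) {u : Fin n}
    (hnd : (adj u).Nodup) (hw : 2 ^ (adj u).length < 2 ^ w)
    (hs : Input n off nb s) (h2 : s.reg 2 = u) (hz : ∀ v : Fin n, s.arr 2 v = 0) :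
    Terminates w labelNeighbours s (5 * (adj u).length + 6) (fun s' => Input n off nb s' ∧
      s'.reg 1 = s.reg 1 ∧ s'.arr 3 = s.arr 3 ∧ s'.arr 4 = s.arr 4 ∧
      (∀ i (hi : i < (adj u).length), s'.arr 2 ((adj u)[i] : Fin n) = 2 ^ i) ∧
      ∀ v : Fin n, v ∉ adj u → s'.arr 2 v = 0) := by
  have hsz := hA.size_lt
  have hun := u.2
  unfold labelNeighbours
  refine .mono_time (.seq (.add ?_ (.seq (.const ?_ (Terminates.mono (terminates_scan hA (v := u)
    ?_ ?_ (T := 2) (J := fun j s' => s'.reg 6 = 2 ^ j ∧ s'.reg 1 = s.reg 1 ∧ s'.arr 3 = s.arr 3 ∧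
      s'.arr 4 = s.arr 4 ∧
      (∀ i (hi : i < (adj u).length), i < j → s'.arr 2 ((adj u)[i] : Fin n) = 2 ^ i) ∧
      ∀ v : Fin n, v ∉ adj u → s'.arr 2 v = 0) ?_ ?_ ?_) le_rfl ?_))))) (le_of_eq ?_)
  · rw [h2, hs.zero]; omega
  · omega
  · constructor <;> simp [hs.size, hs.zero, hs.one, hs.offsets, hs.entries]
  · simp [h2, hs.zero]
  · rintro j s' x k hx ⟨h6, h1, hrest⟩
    refine ⟨?_, ?_, hrest⟩
    · rw [Store.reg_setReg, if_neg (by omega), h6]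
    · rw [Store.reg_setReg, if_neg (by omega), h1]
  · rintro j hj s' hs' ⟨h6, h1, h3, h4, hl, hv⟩ h10
    have hj1 : 2 ^ (j + 1) ≤ 2 ^ (adj u).length := Nat.pow_le_pow_right (by decide) hj
    rw [Nat.pow_succ] at hj1
    refine .seq (.store ?_ (.add ?_ ⟨?_, ⟨?_, ?_, ?_, ?_, ?_, ?_⟩, ?_, ?_⟩))
    · rw [h6]; omega
    · simp [h6]; omega
    · constructor <;> simp [hs'.size, hs'.zero, hs'.one, hs'.offsets, hs'.entries]
    · simp [h6, Nat.pow_succ]; omega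
    · simp [h1]
    · simp [h3]
    · simp [h4]
    · intro i hi hij
      rcases Nat.lt_succ_iff_lt_or_eq.1 hij with hij | rfl
      · have hne : ((adj u)[i] : ℕ) ≠ (adj u)[j] := fun h =>
          hij.ne (hnd.getElem_inj_iff.1 (Fin.ext h))
        simp [h10, Function.update_of_ne hne, hl i hi hij]
      · simp [h10, h6]
    · intro v hvu
      have hne : (v : ℕ) ≠ (adj u)[j] := by
        intro h
        rw [Fin.ext h] at hvu
        exact hvu (List.getElem_mem hj)
      simp [h10, Function.update_of_ne hne, hv v hvu]
    · simp
    · simp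
  · exact ⟨by simp, by simp, rfl, rfl, fun i _ hi => absurd hi (Nat.not_lt_zero i),
      fun v _ => hz v⟩
  · rintro s' ⟨hs', -, h1, h3, h4, hl, hv⟩
    exact ⟨hs', h1, h3, h4, fun i hi => hl i hi hi, hv⟩
  · omega

/-- Stated for arbitrary words `L` obeying the recursion `hrec` along `σ`: when position `i` is
processed, all vertices at smaller positions already carry their final labels, so a single pass
evaluates the recursion. -/
theorem terminates_propagate (hA : IsEncoding w adj off nb) {σ : Equiv.Perm (Fin n)}
    {L L₀ : Fin n → ℕ} (hL : ∀ v, L v < 2 ^ w) (hL₀ : ∀ v, L₀ v < 2 ^ w)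
    (hrec : ∀ v k, (L v).testBit k = true ↔ (L₀ v).testBit k = true ∨
      ∃ z ∈ adj v, σ.symm z < σ.symm v ∧ (L z).testBit k = true)
    (hs : Input n off nb s) (h2 : ∀ v : Fin n, s.arr 2 v = L₀ v)
    (h3 : ∀ i : Fin n, s.arr 3 i = σ i) (h4 : ∀ i : Fin n, s.arr 4 (σ i) = i) :
    Terminates w propagate s (∑ v, (7 * (adj v).length + 9) + 2) (fun s' =>
      s'.reg 1 = s.reg 1 ∧ s'.arr 3 = s.arr 3 ∧ ∀ v : Fin n, s'.arr 2 v = L v) := by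
  have hsz := hA.size_lt
  have h4' : ∀ v : Fin n, s.arr 4 v = (σ.symm v : Fin n) := by
    intro v
    simpa using h4 (σ.symm v)
  unfold propagate
  refine .mono_time (.seq (.const ?_ (Terminates.mono (Terminates.whileLt (I := fun B s' => ∃ i,
      Input n off nb s' ∧ s'.reg 5 = i ∧
      (s'.reg 1 = s.reg 1 ∧ s'.arr 3 = s.arr 3 ∧ s'.arr 4 = s.arr 4) ∧
      (∀ v : Fin n, s'.arr 2 v = if (σ.symm v : ℕ) < i then L v else L₀ v) ∧
      B = ∑ v with i ≤ (σ.symm v : ℕ), (7 * (adj v).length + 9)) ?_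
      ⟨0, ?_, ?_, ?_, ?_, rfl⟩) le_rfl ?_))) ?_
  · omega
  · rintro B s' ⟨i, hs', h5, ⟨hr1, hr3, hr4⟩, hlab, rfl⟩ hlt
    rw [h5, hs'.size] at hlt
    obtain ⟨v, hv⟩ : ∃ v, v = σ ⟨i, hlt⟩ := ⟨_, rfl⟩
    have hvi : σ.symm v = ⟨i, hlt⟩ := by rw [hv, Equiv.symm_apply_apply]
    have hord : s'.arr 3 i = v := by rw [hr3, hv]; exact h3 ⟨i, hlt⟩
    have hlabv : s'.arr 2 v = L₀ v := by rw [hlab, hvi]; simp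
    have hvn := v.2
    refine ⟨7 * (adj v).length + 8,
      ∑ v with i + 1 ≤ (σ.symm v : ℕ), (7 * (adj v).length + 9), ?_, ?_⟩
    · have hins : (Finset.univ.filter fun v => i ≤ (σ.symm v : ℕ)) =
          insert v (Finset.univ.filter fun v => i + 1 ≤ (σ.symm v : ℕ)) := by
        ext z
        simp only [Finset.mem_filter, Finset.mem_univ, true_and, Finset.mem_insert]
        constructor
        · intro h
          rcases Nat.eq_or_lt_of_le h with h | h
          · left
            rw [hv, ← Equiv.symm_apply_eq]
            exact Fin.ext h.symm
          · exact Or.inr h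
        · rintro (rfl | h)
          · rw [hvi]
          · omega
      rw [hins, Finset.sum_insert (by simp [hvi])]
    refine .mono_time (.seq (.load ?_ (.seq (.load ?_ (Terminates.seq (T' := 2) (Terminates.mono
      (terminates_scan hA (v := v) ?_ ?_
      (T := 4) (J := fun j s'' => s''.reg 5 = i ∧ s''.reg 7 = v ∧
        (s''.reg 1 = s.reg 1 ∧ s''.arr 3 = s.arr 3 ∧ s''.arr 4 = s.arr 4) ∧
        s''.arr 2 = s'.arr 2 ∧ s''.reg 12 < 2 ^ w ∧
        ∀ k, (s''.reg 12).testBit k = true ↔ (L₀ v).testBit k = true ∨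
          ∃ l, ∃ hl : l < (adj v).length, l < j ∧ (σ.symm (adj v)[l] : ℕ) < i ∧
            (L (adj v)[l]).testBit k = true) ?_ ?_ ?_) le_rfl ?_)))))) (le_of_eq ?_)
    · rw [h5, hord]; omega
    · simp [h5, hord, hlabv, hL₀]
    · constructor <;> simp [hs'.size, hs'.zero, hs'.one, hs'.offsets, hs'.entries]
    · simp [h5, hord]
    · rintro j s'' x k hx ⟨g5, g7, ⟨g1, g3, g4⟩, g2, g12, gbit⟩
      have h12 : (s''.setReg x k).reg 12 = s''.reg 12 := by
        rw [Store.reg_setReg, if_neg (by omega)]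
      refine ⟨?_, ?_, ⟨?_, g3, g4⟩, g2, h12 ▸ g12, h12 ▸ gbit⟩
      · rw [Store.reg_setReg, if_neg (by omega), g5]
      · rw [Store.reg_setReg, if_neg (by omega), g7]
      · rw [Store.reg_setReg, if_neg (by omega), g1]
    · rintro j hj s'' hs'' ⟨g5, g7, ⟨g1, g3, g4⟩, g2, g12, gbit⟩ h10
      have hpos : s''.arr 4 (s''.reg 10) = (σ.symm (adj v)[j] : Fin n) := by rw [h10, g4, h4']
      have hpn := (σ.symm (adj v)[j]).2
      have hget : (σ.symm (adj v)[j] : ℕ) < i → s''.arr 2 (s''.reg 10) = L (adj v)[j] := by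
        intro h
        rw [h10, g2, hlab, if_pos h]
      have hLj := hL (adj v)[j]
      refine .mono_time (.seq (.load ?_ (.ifLt (T := 2) (fun h => ?_) (fun h => ?_)))) (by omega)
      · rw [hpos]; omega
      · simp only [Store.reg_setReg, Nat.reduceEqDiff, if_true, if_false, hpos, g5] at h
        refine .seq (.load ?_ (.bitOr ?_ ⟨?_, ⟨?_, ?_, ⟨?_, ?_, ?_⟩, ?_, ?_, ?_⟩, ?_, ?_⟩))
        · simp [hget h, hLj]
        · simp [hget h, Nat.or_lt_two_pow g12 hLj]
        · constructor <;> simp [hs''.size, hs''.zero, hs''.one, hs''.offsets, hs''.entries]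
        · simp [g5]
        · simp [g7]
        · simp [g1]
        · simp [g3]
        · simp [g4]
        · simp [g2]
        · simp [hget h, Nat.or_lt_two_pow g12 hLj]
        · intro k
          simp only [Store.reg_setReg, Nat.reduceEqDiff, if_true, if_false, Store.arr_setReg,
            hget h, Nat.testBit_or, Bool.or_eq_true, gbit]
          constructor
          · rintro ((h' | ⟨l, hl, hlj, h'⟩) | h')
            · exact Or.inl h'
            · exact Or.inr ⟨l, hl, by omega, h'⟩
            · exact Or.inr ⟨j, hj, by omega, h, h'⟩
          · rintro (h' | ⟨l, hl, hlj, h'⟩)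
            · exact Or.inl (Or.inl h')
            · rcases Nat.lt_succ_iff_lt_or_eq.1 hlj with hlj | rfl
              · exact Or.inl (Or.inr ⟨l, hl, hlj, h'⟩)
              · exact Or.inr h'.2
        · simp
        · simp
      · simp only [Store.reg_setReg, Nat.reduceEqDiff, if_true, if_false, hpos, g5] at h
        refine .mono_time (.const ?_ ⟨?_, ⟨?_, ?_, ⟨?_, ?_, ?_⟩, ?_, ?_, ?_⟩, ?_, ?_⟩) (by omega)
        · omega
        · constructor <;> simp [hs''.size, hs''.zero, hs''.one, hs''.offsets, hs''.entries]
        · simp [g5]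
        · simp [g7]
        · simp [g1]
        · simp [g3]
        · simp [g4]
        · simp [g2]
        · simp [g12]
        · intro k
          simp only [Store.reg_setReg, Nat.reduceEqDiff, if_false, gbit]
          constructor
          · rintro (h' | ⟨l, hl, hlj, h'⟩)
            · exact Or.inl h'
            · exact Or.inr ⟨l, hl, by omega, h'⟩
          · rintro (h' | ⟨l, hl, hlj, h'⟩)
            · exact Or.inl h'
            · rcases Nat.lt_succ_iff_lt_or_eq.1 hlj with hlj | rfl
              · exact Or.inr ⟨l, hl, hlj, h'⟩
              · exact absurd h'.1 h
        · simp
        · simp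
    · refine ⟨by simp [h5], by simp [h5, hord], ⟨by simp [hr1], hr3, hr4⟩, rfl,
        by simp [h5, hord, hlabv, hL₀], fun k => ?_⟩
      simp [h5, hord, hlabv]
    · rintro s'' ⟨hs'', g5, g7, ⟨g1, g3, g4⟩, g2, g12, gbit⟩
      -- After the whole list the accumulator has collected the start value and the final labels of
      -- all earlier neighbours, which is the right-hand side of `hrec`.
      have hacc : s''.reg 12 = L v := by
        refine Nat.eq_of_testBit_eq fun k => Bool.eq_iff_iff.2 ?_
        rw [gbit, hrec]
        refine or_congr Iff.rfl ⟨?_, ?_⟩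
        · rintro ⟨l, hl, -, hlt', h'⟩
          exact ⟨_, List.getElem_mem hl, by rw [hvi]; exact hlt', h'⟩
        · rintro ⟨z, hz, hlt', h'⟩
          obtain ⟨l, hl, rfl⟩ := List.getElem_of_mem hz
          rw [hvi] at hlt'
          exact ⟨l, hl, hl, hlt', h'⟩
      refine .seq (.store g12 (.add ?_ ⟨i + 1, ?_, ?_, ⟨?_, ?_, ?_⟩, ?_, rfl⟩))
      · simp [g5, hs''.one]; omega
      · constructor <;> simp [hs''.size, hs''.zero, hs''.one, hs''.offsets, hs''.entries]
      · simp [g5, hs''.one]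
      · simp [g1]
      · simp [g3]
      · simp [g4]
      · intro z
        simp only [Store.arr_setReg, Store.arr_setArr, if_true, g7, hacc]
        by_cases hzv : z = v
        · subst hzv
          simp [hvi]
        · have hne : (z : ℕ) ≠ v := fun h => hzv (Fin.ext h)
          have hne' : (σ.symm z : ℕ) ≠ i := by
            intro h
            refine hzv ?_
            rw [hv, ← Equiv.symm_apply_eq]
            exact Fin.ext h
          rw [Function.update_of_ne hne, g2, hlab]
          exact if_congr (by omega) rfl rfl
    · omega
  · constructor <;> simp [hs.size, hs.zero, hs.one, hs.offsets, hs.entries]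
  · simp
  · exact ⟨by simp, rfl, rfl⟩
  · intro v; simp [h2]
  · rintro s' ⟨⟨B, i, hs', h5, ⟨hr1, hr3, -⟩, hlab, -⟩, hnlt⟩
    rw [h5, hs'.size] at hnlt
    exact ⟨hr1, hr3, fun v => by rw [hlab, if_pos (by omega)]⟩
  · simp; omega

end

end Daisy

/-! ### Assembling the phases, with word size and running time -/

namespace Daisy

/-- The complete program. -/
def labelling : Prog := findRoot ;; search ;; labelNeighbours ;; propagate

theorem ofBits_unitWord {h : ℕ} (i : Fin h) : Nat.ofBits (unitWord i) = 2 ^ (i : ℕ) := by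
  refine Nat.eq_of_testBit_eq fun k => ?_
  rw [Nat.testBit_two_pow]
  by_cases hk : k < h
  · rw [Nat.testBit_ofBits_lt _ _ hk]
    simp [unitWord, Fin.ext_iff, eq_comm]
  · rw [Nat.testBit_ofBits_ge _ _ (not_lt.1 hk)]
    have := i.2
    simp; omega

theorem ofBits_false {h : ℕ} : Nat.ofBits (fun _ : Fin h => false) = 0 := by
  refine Nat.eq_of_testBit_eq fun k => ?_
  by_cases hk : k < h
  · rw [Nat.testBit_ofBits_lt _ _ hk, Nat.zero_testBit]
  · rw [Nat.testBit_ofBits_ge _ _ (not_lt.1 hk), Nat.zero_testBit]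

/-- The words of the labelling, as numbers, satisfy the recursion along a breadth-first order. -/
theorem IsRootedLabelling.testBit_iff {n : ℕ} {G : SimpleGraph (Fin n)} (hG : G.Connected)
    {u : Fin n} (hne : ∀ v z, G.Adj v z → G.dist u v ≠ G.dist u z)
    {σ : Equiv.Perm (Fin n)} (hσ : IsBFSOrder G u σ) {h : ℕ} {e : Fin h ≃ G.neighborSet u}
    {β : Fin n → (Fin h → Bool)} (hβ : IsRootedLabelling G u e β) {L₀ : Fin n → ℕ}
    (hnear : ∀ v, v = u ∨ G.Adj u v → L₀ v = Nat.ofBits (β v))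
    (hfar : ∀ v, ¬ (v = u ∨ G.Adj u v) → L₀ v = 0) (v : Fin n) (k : ℕ) :
    (Nat.ofBits (β v)).testBit k = true ↔ (L₀ v).testBit k = true ∨
      ∃ z, G.Adj v z ∧ σ.symm z < σ.symm v ∧ (Nat.ofBits (β z)).testBit k = true := by
  have hL₀ : (L₀ v).testBit k = true ↔
      (v = u ∨ G.Adj u v) ∧ (Nat.ofBits (β v)).testBit k = true := by
    by_cases hv : v = u ∨ G.Adj u v
    · simp [hnear v hv, hv]
    · simp [hfar v hv, hv]
  rw [hL₀]
  by_cases hk : k < h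
  · simp only [Nat.testBit_ofBits_lt _ _ hk]
    exact hβ.apply_iff hG hne hσ v ⟨k, hk⟩
  · simp [Nat.testBit_ofBits_ge _ _ (not_lt.1 hk)]

/-- Offsets are partial sums of degrees, hence at most twice the number of edges; this makes
addresses fit in a word. -/
theorem offset_eq {n : ℕ} {len : Fin n → ℕ} {off : ℕ → ℕ} (h0 : off 0 = 0)
    (hnext : ∀ v : Fin n, off ((v : ℕ) + 1) = off v + len v) (i : ℕ) (hi : i ≤ n) :
    off i = ∑ v ∈ Finset.univ.filter (fun v : Fin n => (v : ℕ) < i), len v := by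
  induction i with
  | zero => simp [h0]
  | succ i ih =>
    have hins : (Finset.univ.filter fun v : Fin n => (v : ℕ) < i + 1) =
        insert ⟨i, hi⟩ (Finset.univ.filter fun v : Fin n => (v : ℕ) < i) := by
      ext v
      simp [Fin.ext_iff]
      omega
    rw [hins, Finset.sum_insert (by simp), hnext ⟨i, hi⟩, ih (by omega), Nat.add_comm]

end Daisy

open Daisy in
theorem theorem4p9 :
    ∃ (P : Daisy.Prog) (C : ℕ),
      ∀ (n : ℕ) (G : SimpleGraph (Fin n)) [DecidableRel G.Adj] (h : ℕ),
        Daisy.IsDaisyCube G → Daisy.IsIsometricDimension G h →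
        ∀ (w : ℕ), C * (h + 1) ≤ w →
        ∀ (s : Daisy.Store), Daisy.HoldsGraph s G →
          ∃ (t : ℕ) (s' : Daisy.Store),
            Daisy.Exec w P s t s' ∧
            t ≤ C * (G.edgeFinset.card + 1) ∧
            ∃ (u : Fin n) (σ : Equiv.Perm (Fin n)) (β : Fin n → (Fin h → Bool)),
              Daisy.HoldsLabelling s' β σ ∧
              Daisy.IsIsometricEmbedding G β ∧
              Daisy.IsBFSLabelling G u σ β := by
  -- A generous constant: with `m` edges the phases take at most `40 * m + 26 * n + 19` steps, where
  -- `n ≤ m + 1`, and words of `2 * h + 2` bits suffice.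
  refine ⟨labelling, 100, ?_⟩
  intro n G _ h hG hh w hw s ⟨adj, hadj, h0, hoff0, hmem⟩
  obtain ⟨⟨v₀⟩, k, α, hα⟩ := hG.exists_labelling
  have : Nonempty (Fin n) := ⟨v₀⟩
  have hn : 0 < n := v₀.pos
  have hconn : G.Connected := hα.connected
  have hlen : ∀ v, (adj v).length = G.degree v := by
    intro v
    rw [← List.toFinset_card_of_nodup (hadj v).1, ← SimpleGraph.card_neighborFinset_eq_degree]
    congr 1
    ext z
    simp [(hadj v).2 z]
  have hsumlen : ∑ v, (adj v).length = 2 * G.edgeFinset.card := by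
    rw [← G.sum_degrees_eq_twice_card_edges]
    exact Finset.sum_congr rfl fun v _ => hlen v
  have hnm : n ≤ G.edgeFinset.card + 1 := by
    have := hconn.card_vert_le_card_edgeSet_add_one
    rwa [Nat.card_fin, Nat.card_eq_fintype_card, ← SimpleGraph.edgeFinset_card] at this
  -- An isometric embedding is injective, so the dimension bounds the number of vertices, and hence
  -- that of edges; `2 * h` bits thus essentially suffice for addresses.
  have hn2 : n ≤ 2 ^ h := by
    obtain ⟨γ, hγ⟩ := hh.1
    have := Fintype.card_le_of_injective γ (hγ.injective hconn)
    simpa using this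
  have hm2 : 2 * G.edgeFinset.card ≤ 2 ^ (2 * h) := by
    have h1 : ∑ v, (adj v).length ≤ ∑ _v : Fin n, n := Finset.sum_le_sum fun v _ => by
      have := G.degree_lt_card_verts v
      rw [Fintype.card_fin] at this
      rw [hlen]
      omega
    rw [hsumlen, Finset.sum_const, Finset.card_univ, Fintype.card_fin, smul_eq_mul] at h1
    refine h1.trans ((Nat.mul_le_mul hn2 hn2).trans (le_of_eq ?_))
    rw [← pow_add, two_mul]
  have hbig : 2 ^ (2 * h) * 4 ≤ 2 ^ w := by
    have : 2 ^ (2 * h) * 4 = 2 ^ (2 * h + 2) := by rw [pow_add]; rfl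
    rw [this]
    exact Nat.pow_le_pow_right (by decide) (by omega)
  have hhh : 2 ^ h ≤ 2 ^ (2 * h) := Nat.pow_le_pow_right (by decide) (by omega)
  have hpos : 0 < 2 ^ h := by positivity
  have hA : IsEncoding w adj (s.arr 0) (s.arr 1) := by
    refine ⟨fun v => (hmem v).1, fun v => (hmem v).2, fun v => ?_, by omega⟩
    rw [← (hmem v).1, offset_eq hoff0 (fun v => (hmem v).1) ((v : ℕ) + 1) v.2]
    have : ∑ x ∈ Finset.univ.filter (fun x : Fin n => (x : ℕ) < v + 1), (adj x).length ≤
        ∑ v, (adj v).length :=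
      Finset.sum_le_sum_of_subset (Finset.subset_univ _)
    omega
  suffices Terminates w labelling s (100 * (G.edgeFinset.card + 1)) fun s' =>
      ∃ (u : Fin n) (σ : Equiv.Perm (Fin n)) (β : Fin n → (Fin h → Bool)),
        HoldsLabelling s' β σ ∧ IsIsometricEmbedding G β ∧ IsBFSLabelling G u σ β by
    exact this
  have hsum8 : ∑ v, (8 * (adj v).length + 7) = 16 * G.edgeFinset.card + 7 * n := by
    rw [Finset.sum_add_distrib, ← Finset.mul_sum, hsumlen]
    simp
    omega
  have hsum7 : ∑ v, (7 * (adj v).length + 9) = 14 * G.edgeFinset.card + 9 * n := by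
    rw [Finset.sum_add_distrib, ← Finset.mul_sum, hsumlen]
    simp
    omega
  have hlen_le : ∀ v, (adj v).length ≤ 2 * G.edgeFinset.card := fun v =>
    hsumlen ▸ Finset.single_le_sum (f := fun v => (adj v).length) (fun _ _ => Nat.zero_le _)
      (Finset.mem_univ v)
  unfold labelling
  refine Terminates.mono_time (T := (10 * n + 6) + ((16 * G.edgeFinset.card + 7 * n + 5) +
    ((10 * G.edgeFinset.card + 6) + (14 * G.edgeFinset.card + 9 * n + 2)))) ?_ (by omega)
  refine .seq ((terminates_findRoot hA hn h0 rfl rfl).mono le_rfl ?_)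
  rintro s₁ ⟨hs₁, u, hu₁, hd₁, hmax, hclear⟩
  have hmax' : ∀ v, G.degree v ≤ G.degree u := fun v => by
    rw [← hlen, ← hlen]; exact hmax v
  have hdeg : (adj u).length = h := by
    rw [hlen]; exact hα.degree_eq_dimension hmax' hh
  refine .seq ((terminates_search hA (fun v => (hadj v).2) hconn hs₁ hu₁
    fun v => (hclear v).1).mono (by omega) ?_)
  rintro s₂ ⟨hs₂, hd₂, hu₂, hlab₂, σ, hσ, hord⟩
  refine .seq ((terminates_labelNeighbours hA (hadj u).1 (by rw [hdeg]; omega) hs₂ hu₂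
    fun v => by rw [hlab₂]; exact (hclear v).2).mono (by have := hlen_le u; omega) ?_)
  rintro s₃ ⟨hs₃, hd₃, hord₃, hpos₃, hunit, hzero⟩
  subst hdeg
  -- The neighbours of `u` are numbered in the order of its input list, so that the abstract unit
  -- words agree with the powers of two written by the program.
  let e : Fin (adj u).length ≃ G.neighborSet u :=
    ((hadj u).1.getEquiv (adj u)).trans (Equiv.subtypeEquivRight fun z => (hadj u).2 z)
  obtain ⟨β, hβ⟩ := hα.exists_rooted hmax' e
  have hlt : ∀ v, Nat.ofBits (β v) < 2 ^ w := fun v =>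
    (Nat.ofBits_lt_two_pow (β v)).trans_le (by omega)
  have hnear : ∀ v : Fin n, v = u ∨ G.Adj u v → s₃.arr 2 v = Nat.ofBits (β v) := by
    rintro v (rfl | hv)
    · rw [hβ.root, ofBits_false]
      exact hzero v fun h => G.irrefl (((hadj v).2 v).1 h)
    · obtain ⟨i, hi⟩ := e.surjective ⟨v, hv⟩
      have h1 : β v = unitWord i := by rw [← hβ.neighbours i, hi]
      have h2 : (adj u)[(i : ℕ)] = v := congrArg Subtype.val hi
      rw [h1, ofBits_unitWord, ← hunit i i.2, h2]
  have hfar : ∀ v : Fin n, ¬ (v = u ∨ G.Adj u v) → s₃.arr 2 v = 0 := fun v hv =>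
    hzero v fun h => hv (Or.inr (((hadj u).2 v).1 h))
  have hrec := hβ.testBit_iff hconn (fun v z => hα.dist_ne u) hσ
    (L₀ := fun v => s₃.arr 2 v) hnear hfar
  refine (terminates_propagate hA (σ := σ) (L := fun v => Nat.ofBits (β v))
    (L₀ := fun v => s₃.arr 2 v) hlt ?_ ?_ hs₃ (fun v => rfl) ?_ ?_).mono (by omega) ?_
  · intro v
    by_cases hv : v = u ∨ G.Adj u v
    · simp only [hnear v hv]; exact hlt v
    · simp only [hfar v hv]; positivity
  · intro v k
    rw [hrec]
    simp only [(hadj v).2]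
  · intro i; rw [hord₃]; exact (hord i).1
  · intro i; rw [hpos₃]; exact (hord i).2
  · rintro s₄ ⟨hd₄, hord₄, hlab⟩
    refine ⟨u, σ, β, ⟨?_, fun v => ⟨?_, fun i => ?_⟩, fun i => ?_⟩, hβ.isometric,
      ⟨(hlen u).symm, hσ, hβ.root, ⟨e, hβ.neighbours⟩, hβ.later⟩⟩
    · rw [hd₄, hd₃, hd₂, hd₁]
    · rw [hlab]; exact Nat.ofBits_lt_two_pow _
    · rw [hlab, Nat.testBit_ofBits_lt _ _ i.2]
    · rw [hord₄, hord₃]; exact (hord i).1
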